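/- Let $\Bbbk$ be a field and let $L$ be a left Leibniz algebra over $\Bbbk$, that is, a space with a bilinear operation $[\cdot\,\cdot]$ such that $[x[yz]]=[[xy]z]+[y[xz]]$. Let $L^{\mathrm{alg}}$ be the Lie algebra $L/\mathrm{Span}\{[aa] \mid a\in L\}$ (if $\mathrm{char}\,\Bbbk\neq 2$, this span is $\mathrm{Span}\{[ab]+[ba]\mid a,b\in L\}$), let $\bar a$ be the image of $a\in L$ in $L^{\mathrm{alg}}$, and let $V=U(L^{\mathrm{alg}})$ be the universal enveloping algebra, considered as a left $L^{\mathrm{alg}}$-module by left multiplication. Let $H=\Bbbk[T]$ with $\Delta(T)=T\otimes1+1\otimes T$ and $\varepsilon(h)=h(0)$. For a left $H$-module $M$ let $\mathrm{Cend}\,M$ be the space of linear maps $a:M\to (H\otimes H)\otimes_H M$ such that $a(hu)=(1\otimes h\otimes_H\mathrm{id})\,a(u)$ for $h\in H$, $u\in M$, where $H\otimes H$ is a right $H$-module via $\Delta$. Every element of $(H\otimes H)\otimes_H M$ can be written as $\sum_i h_i\otimes 1\otimes_H v_i$. The associative dialgebra $\mathrm{Cend}\,M^{(0)}$ is the space $\mathrm{Cend}\,M$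 with the operations $$(a\vdash b)(u)=\sum_{i,j}h_j(0)\,h_i\otimes1\otimes_H w_{ij},\qquad (a\dashv b)(u)=\sum_{i,j}h_i(0)\,h_j\otimes1\otimes_H w_{ij},$$ where $b(u)=\sum_i h_i\otimes1\otimes_H v_i$ and $a(v_i)=\sum_j h_j\otimes 1\otimes_H w_{ij}$. Let $M=H\otimes M_0$ with $M_0=V\oplus(L\otimes V)$, and let $\rho_U:L\to \mathrm{Cend}\,M$ be the conformal representation $$\rho_U(a)(v)=1\otimes1\otimes_H\bar a v-T\otimes1\otimes_H(a\otimes v),\qquad \rho_U(a)(b\otimes v)=1\otimes1\otimes_H\bigl(b\otimes\bar a v+[ab]\otimes v\bigr),$$ for $a,b\in L$, $v\in V$; it satisfies $\rho_U([ab])=\rho_U(a)\vdash\rho_U(b)-\rho_U(b)\dashv\rho_U(a)$. Let $U(L)$ be the universal enveloping associative dialgebra of $L$: the quotient of the free associative dialgebra generated by the space $L$ by the ideal generated by all $a\vdash b-b\dashv a-[ab]$, $a,b\in L$. Write $\tilde c$ for the image of $c\in L$ in $U(L)$, and let $U(\rho_U):U(L)\to \mathrm{Cend}\,M^{(0)}$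 be the homomorphism of dialgebras that extends $\rho_U$. Then $U(\rho_U)$ is faithful, i.e. injective. Moreover, let $B=\{a_i\mid i\in I\}\cup\{b_j\mid j\in J\}$ be any basis of $L$ such that $\{\bar a_i\mid i\in I\}$ is a basis of $L^{\mathrm{alg}}$ and $\bar b_j=0$ for all $j\in J$, and let $I$ be linearly ordered. Then the words $$\tilde c\dashv\tilde a_{i_1}\dashv\dots\dashv\tilde a_{i_n},\qquad c\in B,\ i_1\le\dots\le i_n,\ n\ge0,$$ span $U(L)$, and their images under $U(\rho_U)$ are linearly independent. -/

import Mathlib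

set_option maxSynthPendingDepth 3

open scoped TensorProduct Polynomial

noncomputable section

namespace ConfLeibniz

universe u v w

/-! ## Leibniz algebras and associative dialgebras -/

/-- A left Leibniz algebra over `k`: a bilinear operation `[x y] = bracket x y` with
`[x [y z]] = [[x y] z] + [y [x z]]`. -/
class LeibnizAlgebra (k : Type u) (L : Type v) [CommRing k] [AddCommGroup L] [Module k L] where
  bracket : L →ₗ[k] L →ₗ[k] L
  leibniz : ∀ x y z : L,
    bracket x (bracket y z) = bracket (bracket x y) z + bracket y (bracket x z)

/-- The bracket `[x y]` of a Leibniz algebra. -/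
abbrev br (k : Type u) {L : Type v} [CommRing k] [AddCommGroup L] [Module k L]
    [LeibnizAlgebra k L] (x y : L) : L :=
  LeibnizAlgebra.bracket (k := k) x y

/-- An associative dialgebra over `k`: `lp x y` is `x ⊣ y` and `rp x y` is `x ⊢ y`. -/
class AssocDialgebra (k : Type u) (A : Type v) [CommRing k] [AddCommGroup A] [Module k A] where
  lp : A →ₗ[k] A →ₗ[k] A
  rp : A →ₗ[k] A →ₗ[k] A
  rp_bar : ∀ x y z : A, rp (lp x y) z = rp (rp x y) z
  lp_bar : ∀ x y z : A, lp x (rp y z) = lp x (lp y z)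
  lp_assoc : ∀ x y z : A, lp (lp x y) z = lp x (lp y z)
  mid_assoc : ∀ x y z : A, lp (rp x y) z = rp x (lp y z)
  rp_assoc : ∀ x y z : A, rp (rp x y) z = rp x (rp y z)

/-- The operation `x ⊣ y`. -/
abbrev lp (k : Type u) {A : Type v} [CommRing k] [AddCommGroup A] [Module k A]
    [AssocDialgebra k A] (x y : A) : A :=
  AssocDialgebra.lp (k := k) x y

/-- The operation `x ⊢ y`. -/
abbrev rp (k : Type u) {A : Type v} [CommRing k] [AddCommGroup A] [Module k A]
    [AssocDialgebra k A] (x y : A) : A :=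
  AssocDialgebra.rp (k := k) x y

/-- Homomorphisms of associative dialgebras. -/
structure DialgHom (k : Type u) (A : Type v) (B : Type w) [CommRing k]
    [AddCommGroup A] [Module k A] [AssocDialgebra k A]
    [AddCommGroup B] [Module k B] [AssocDialgebra k B] extends A →ₗ[k] B where
  map_lp : ∀ x y : A, toLinearMap (lp k x y) = lp k (toLinearMap x) (toLinearMap y)
  map_rp : ∀ x y : A, toLinearMap (rp k x y) = rp k (toLinearMap x) (toLinearMap y)

/-- Homomorphisms of Leibniz algebras. -/
structure LeibnizHom (k : Type u) (L : Type v) (L' : Type w) [CommRing k]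
    [AddCommGroup L] [Module k L] [LeibnizAlgebra k L]
    [AddCommGroup L'] [Module k L'] [LeibnizAlgebra k L'] extends L →ₗ[k] L' where
  map_br : ∀ x y : L, toLinearMap (br k x y) = br k (toLinearMap x) (toLinearMap y)

/-- The underlying space of the adjoint Leibniz algebra `A⁽⁻⁾` of an associative dialgebra. -/
def Minus (A : Type v) : Type v := A

section Minus

variable (k : Type u) (A : Type v) [CommRing k] [AddCommGroup A] [Module k A]

instance : AddCommGroup (Minus A) := inferInstanceAs (AddCommGroup A)
instance : Module k (Minus A) := inferInstanceAs (Module k A)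

/-- The adjoint Leibniz algebra `A⁽⁻⁾`: the space `A` with `[x y] = x ⊢ y - y ⊣ x`. -/
instance instLeibnizMinus [AssocDialgebra k A] : LeibnizAlgebra k (Minus A) where
  bracket := ((AssocDialgebra.rp - AssocDialgebra.lp.flip : A →ₗ[k] A →ₗ[k] A) :)
  leibniz := by
    intro x y z
    change A at x y z
    change (rp k x (rp k y z - lp k z y) - lp k (rp k y z - lp k z y) x : A) =
      (rp k (rp k x y - lp k y x) z - lp k z (rp k x y - lp k y x))
      + (rp k y (rp k x z - lp k z x) - lp k (rp k x z - lp k z x) y)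
    simp only [lp, rp, map_sub, LinearMap.sub_apply, AssocDialgebra.rp_bar,
      AssocDialgebra.lp_bar, AssocDialgebra.lp_assoc, AssocDialgebra.mid_assoc,
      AssocDialgebra.rp_assoc]
    abel

/-- The identity map `A⁽⁻⁾ → A`. -/
def Minus.out : Minus A ≃ₗ[k] A := LinearEquiv.refl k A

theorem Minus.out_br [AssocDialgebra k A] (x y : Minus A) :
    Minus.out k A (br k x y) =
      rp k (Minus.out k A x) (Minus.out k A y) - lp k (Minus.out k A y) (Minus.out k A x) := rfl

end Minus

/-! ## The universal enveloping associative dialgebra `U(L)` -/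

section Free

variable (k : Type u) (L : Type v) [CommRing k] [AddCommGroup L] [Module k L]

/-- The free associative dialgebra `F(L)` generated by the space `L`: its underlying space is
`T(L) ⊗ L ⊗ T(L)`, where `T(L)` is the tensor algebra. The tensor `u ⊗ x ⊗ v` stands for
`u ⊢ x ⊣ v`. -/
abbrev FreeDialg : Type (max u v) :=
  TensorAlgebra k L ⊗[k] (L ⊗[k] TensorAlgebra k L)

namespace FreeDialg

/-- `(u ⊗ x ⊗ v) ↦ t u ⊗ x ⊗ v`. -/
def lact : TensorAlgebra k L →ₗ[k] FreeDialg k L →ₗ[k] FreeDialg k L :=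
  LinearMap.rTensorHom _ ∘ₗ LinearMap.mul k (TensorAlgebra k L)

/-- `(u ⊗ x ⊗ v) ↦ u ⊗ x ⊗ v t`. -/
def ract : TensorAlgebra k L →ₗ[k] FreeDialg k L →ₗ[k] FreeDialg k L :=
  LinearMap.lTensorHom _ ∘ₗ LinearMap.lTensorHom _ ∘ₗ (LinearMap.mul k (TensorAlgebra k L)).flip

/-- `(u ⊗ x ⊗ v) ↦ u x v`. -/
def proj : FreeDialg k L →ₗ[k] TensorAlgebra k L :=
  LinearMap.mul' k _ ∘ₗ
    LinearMap.lTensor _ (LinearMap.mul' k _ ∘ₗ LinearMap.rTensor _ (TensorAlgebra.ι k))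

variable {k L}

@[simp] theorem lact_tmul (t u : TensorAlgebra k L) (y : L ⊗[k] TensorAlgebra k L) :
    lact k L t (u ⊗ₜ y) = (t * u) ⊗ₜ y := rfl

@[simp] theorem ract_tmul (t u v : TensorAlgebra k L) (x : L) :
    ract k L t (u ⊗ₜ (x ⊗ₜ v)) = u ⊗ₜ (x ⊗ₜ (v * t)) := rfl

@[simp] theorem proj_tmul (u v : TensorAlgebra k L) (x : L) :
    proj k L (u ⊗ₜ (x ⊗ₜ v)) = u * (TensorAlgebra.ι k x * v) := by
  simp [proj]

theorem induction_on {P : FreeDialg k L → Prop} (X : FreeDialg k L) (h0 : P 0)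
    (ht : ∀ u x v, P (u ⊗ₜ (x ⊗ₜ v))) (ha : ∀ X Y, P X → P Y → P (X + Y)) : P X := by
  induction X using TensorProduct.induction_on with
  | zero => exact h0
  | add X Y hX hY => exact ha X Y hX hY
  | tmul u y =>
    induction y using TensorProduct.induction_on with
    | zero => simpa using h0
    | add X Y hX hY => rw [TensorProduct.tmul_add]; exact ha _ _ hX hY
    | tmul x v => exact ht u x v

theorem lact_mul (s t : TensorAlgebra k L) (X : FreeDialg k L) :
    lact k L (s * t) X = lact k L s (lact k L t X) := by
  induction X using induction_on with
  | h0 => simp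
  | ht u x v => simp [mul_assoc]
  | ha X Y hX hY => simp [hX, hY]

theorem ract_mul (s t : TensorAlgebra k L) (X : FreeDialg k L) :
    ract k L (s * t) X = ract k L t (ract k L s X) := by
  induction X using induction_on with
  | h0 => simp
  | ht u x v => simp [mul_assoc]
  | ha X Y hX hY => simp [hX, hY]

theorem ract_lact (s t : TensorAlgebra k L) (X : FreeDialg k L) :
    ract k L t (lact k L s X) = lact k L s (ract k L t X) := by
  induction X using induction_on with
  | h0 => simp
  | ht u x v => simp
  | ha X Y hX hY => simp [hX, hY]

theorem proj_lact (t : TensorAlgebra k L) (X : FreeDialg k L) :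
    proj k L (lact k L t X) = t * proj k L X := by
  induction X using induction_on with
  | h0 => simp
  | ht u x v => simp [mul_assoc]
  | ha X Y hX hY => simp [hX, hY, mul_add]

theorem proj_ract (t : TensorAlgebra k L) (X : FreeDialg k L) :
    proj k L (ract k L t X) = proj k L X * t := by
  induction X using induction_on with
  | h0 => simp
  | ht u x v => simp [mul_assoc]
  | ha X Y hX hY => simp [hX, hY, add_mul]

/-- The operations of the free associative dialgebra:
`(u ⊗ x ⊗ v) ⊣ (u' ⊗ x' ⊗ v') = u ⊗ x ⊗ v u' x' v'` and
`(u ⊗ x ⊗ v) ⊢ (u' ⊗ x' ⊗ v') = u x v u' ⊗ x' ⊗ v'`. -/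
instance : AssocDialgebra k (FreeDialg k L) where
  lp := (ract k L ∘ₗ proj k L).flip
  rp := lact k L ∘ₗ proj k L
  rp_bar x y z := by simp [proj_lact, proj_ract]
  lp_bar x y z := by simp [proj_lact, proj_ract]
  lp_assoc x y z := by simp [proj_ract, ract_mul]
  mid_assoc x y z := by simp [ract_lact]
  rp_assoc x y z := by simp [proj_lact, lact_mul]

theorem lp_def (X Y : FreeDialg k L) : lp k X Y = ract k L (proj k L Y) X := rfl
theorem rp_def (X Y : FreeDialg k L) : rp k X Y = lact k L (proj k L X) Y := rfl

variable (k) in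
/-- The inclusion `L → F(L)`, `x ↦ 1 ⊗ x ⊗ 1`. -/
def of : L →ₗ[k] FreeDialg k L :=
  TensorProduct.mk k _ _ 1 ∘ₗ (TensorProduct.mk k L (TensorAlgebra k L)).flip 1

theorem of_apply (x : L) : of k x = (1 : TensorAlgebra k L) ⊗ₜ[k] (x ⊗ₜ[k] 1) := rfl

@[simp] theorem proj_of (x : L) : proj k L (of k x) = TensorAlgebra.ι k x := by
  simp [of_apply]

section lift

variable {A : Type w} [AddCommGroup A] [Module k A] [AssocDialgebra k A] (f : L →ₗ[k] A)

/-- `x₁ ⋯ xₙ ↦ (a ↦ f x₁ ⊢ (⋯ ⊢ (f xₙ ⊢ a)))`. -/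
def lamb : TensorAlgebra k L →ₐ[k] Module.End k A :=
  TensorAlgebra.lift k ((AssocDialgebra.rp : A →ₗ[k] A →ₗ[k] A) ∘ₗ f)

/-- `x₁ ⋯ xₙ ↦ (a ↦ ((a ⊣ f x₁) ⊣ ⋯) ⊣ f xₙ)`. -/
def rhob : TensorAlgebra k L →ₐ[k] (Module.End k A)ᵐᵒᵖ :=
  TensorAlgebra.lift k ((MulOpposite.opLinearEquiv k).toLinearMap ∘ₗ
    (AssocDialgebra.lp : A →ₗ[k] A →ₗ[k] A).flip ∘ₗ f)

/-- `u ⊗ x ⊗ v ↦ u ⊢ f x ⊣ v`. -/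
def liftLin : FreeDialg k L →ₗ[k] A :=
  TensorProduct.lift ((LinearMap.lcomp k A
    (TensorProduct.lift ((((MulOpposite.opLinearEquiv k).symm.toLinearMap ∘ₗ
      (rhob f).toLinearMap).flip) ∘ₗ f))) ∘ₗ (lamb f).toLinearMap)

theorem liftLin_tmul (u v : TensorAlgebra k L) (x : L) :
    liftLin f (u ⊗ₜ (x ⊗ₜ v)) = lamb f u ((rhob f v).unop (f x)) := by
  rfl

theorem lamb_ι (x : L) (a : A) : lamb f (TensorAlgebra.ι k x) a = rp k (f x) a := by
  simp [lamb]

theorem rhob_ι (x : L) (a : A) : (rhob f (TensorAlgebra.ι k x)).unop a = lp k a (f x) := by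
  simp [rhob]

theorem lamb_rp (u : TensorAlgebra k L) (a b : A) :
    rp k (lamb f u a) b = lamb f u (rp k a b) := by
  induction u using TensorAlgebra.induction generalizing a b with
  | algebraMap r => simp [Algebra.algebraMap_eq_smul_one, lp, rp]
  | ι x => rw [lamb_ι, lamb_ι]; exact AssocDialgebra.rp_assoc _ _ _
  | mul s t hs ht => rw [map_mul, Module.End.mul_apply, hs, ht]; rfl
  | add s t hs ht => simpa [lp, rp] using congrArg₂ (· + ·) (hs a b) (ht a b)

theorem lp_lamb (u : TensorAlgebra k L) (a b : A) :
    lp k (lamb f u a) b = lamb f u (lp k a b) := by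
  induction u using TensorAlgebra.induction generalizing a b with
  | algebraMap r => simp [Algebra.algebraMap_eq_smul_one, lp, rp]
  | ι x => rw [lamb_ι, lamb_ι]; exact AssocDialgebra.mid_assoc _ _ _
  | mul s t hs ht => rw [map_mul, Module.End.mul_apply, hs, ht]; rfl
  | add s t hs ht => simpa [lp, rp] using congrArg₂ (· + ·) (hs a b) (ht a b)

theorem rhob_mul (s t : TensorAlgebra k L) (a : A) :
    (rhob f (s * t)).unop a = (rhob f t).unop ((rhob f s).unop a) := by
  simp

theorem lp_rhob (v : TensorAlgebra k L) (a b : A) :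
    lp k a ((rhob f v).unop b) = (rhob f v).unop (lp k a b) := by
  induction v using TensorAlgebra.induction generalizing a b with
  | algebraMap r => simp [Algebra.algebraMap_eq_smul_one, lp, rp]
  | ι x => rw [rhob_ι, rhob_ι]; exact (AssocDialgebra.lp_assoc _ _ _).symm
  | mul s t hs ht => rw [rhob_mul, rhob_mul, ht, hs]
  | add s t hs ht => simpa [lp, rp] using congrArg₂ (· + ·) (hs a b) (ht a b)

theorem rp_rhob (v : TensorAlgebra k L) (a b : A) :
    rp k ((rhob f v).unop a) b = rp k a (lamb f v b) := by
  induction v using TensorAlgebra.induction generalizing a b with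
  | algebraMap r => simp [Algebra.algebraMap_eq_smul_one, lp, rp]
  | ι x =>
    rw [rhob_ι, lamb_ι]
    exact (AssocDialgebra.rp_bar _ _ _).trans (AssocDialgebra.rp_assoc _ _ _)
  | mul s t hs ht => rw [rhob_mul, ht, hs, map_mul, Module.End.mul_apply]
  | add s t hs ht => simpa [lp, rp] using congrArg₂ (· + ·) (hs a b) (ht a b)

theorem lp_lamb_right (u : TensorAlgebra k L) (a b : A) :
    lp k a (lamb f u b) = lp k ((rhob f u).unop a) b := by
  induction u using TensorAlgebra.induction generalizing a b with
  | algebraMap r => simp [Algebra.algebraMap_eq_smul_one, lp, rp]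
  | ι x =>
    rw [rhob_ι, lamb_ι]
    exact (AssocDialgebra.lp_bar _ _ _).trans (AssocDialgebra.lp_assoc _ _ _).symm
  | mul s t hs ht => rw [rhob_mul, ← ht, ← hs, map_mul, Module.End.mul_apply]
  | add s t hs ht => simpa [lp, rp] using congrArg₂ (· + ·) (hs a b) (ht a b)

theorem rhob_lamb (u v : TensorAlgebra k L) (a : A) :
    (rhob f v).unop (lamb f u a) = lamb f u ((rhob f v).unop a) := by
  induction v using TensorAlgebra.induction generalizing a with
  | algebraMap r => simp [Algebra.algebraMap_eq_smul_one, lp, rp]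
  | ι x => rw [rhob_ι, rhob_ι, lp_lamb]
  | mul s t hs ht => rw [rhob_mul, rhob_mul, hs, ht]
  | add s t hs ht => simpa [lp, rp] using congrArg₂ (· + ·) (hs a) (ht a)

theorem lamb_proj (X : FreeDialg k L) (b : A) :
    lamb f (proj k L X) b = rp k (liftLin f X) b := by
  induction X using induction_on with
  | h0 => simp [lp, rp]
  | ht u x v =>
    rw [proj_tmul, liftLin_tmul, lamb_rp, rp_rhob, map_mul, map_mul, Module.End.mul_apply,
      Module.End.mul_apply, lamb_ι]
  | ha X Y hX hY => simpa [lp, rp] using congrArg₂ (· + ·) hX hY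

theorem rhob_proj (X : FreeDialg k L) (b : A) :
    (rhob f (proj k L X)).unop b = lp k b (liftLin f X) := by
  induction X using induction_on with
  | h0 => simp [lp, rp]
  | ht u x v =>
    rw [proj_tmul, liftLin_tmul, lp_lamb_right, lp_rhob, rhob_mul, rhob_mul, rhob_ι]
  | ha X Y hX hY => simpa [lp, rp] using congrArg₂ (· + ·) hX hY

theorem liftLin_lact (t : TensorAlgebra k L) (X : FreeDialg k L) :
    liftLin f (lact k L t X) = lamb f t (liftLin f X) := by
  induction X using induction_on with
  | h0 => simp
  | ht u x v => rw [lact_tmul, liftLin_tmul, liftLin_tmul, map_mul, Module.End.mul_apply]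
  | ha X Y hX hY => simp [hX, hY]

theorem liftLin_ract (t : TensorAlgebra k L) (X : FreeDialg k L) :
    liftLin f (ract k L t X) = (rhob f t).unop (liftLin f X) := by
  induction X using induction_on with
  | h0 => simp
  | ht u x v => rw [ract_tmul, liftLin_tmul, liftLin_tmul, rhob_lamb, rhob_mul]
  | ha X Y hX hY => simp [hX, hY]

/-- The universal property of the free associative dialgebra: existence. -/
def lift : DialgHom k (FreeDialg k L) A where
  toLinearMap := liftLin f
  map_lp X Y := by
    change liftLin f (lp k X Y) = lp k (liftLin f X) (liftLin f Y)
    rw [lp_def, liftLin_ract, rhob_proj]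
  map_rp X Y := by
    change liftLin f (rp k X Y) = rp k (liftLin f X) (liftLin f Y)
    rw [rp_def, liftLin_lact, lamb_proj]

theorem lift_of (x : L) : (lift f).toLinearMap (of k x) = f x := by
  change liftLin f (of k x) = f x
  rw [of_apply, liftLin_tmul]; simp

end lift

end FreeDialg

end Free

section Envelope

variable (k : Type u) [CommRing k]

/-- Two-sided ideals of a dialgebra. -/
structure IsDialgIdeal {A : Type v} [AddCommGroup A] [Module k A] [AssocDialgebra k A]
    (I : Submodule k A) : Prop where
  lp_left : ∀ x y : A, x ∈ I → lp k x y ∈ I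
  lp_right : ∀ x y : A, y ∈ I → lp k x y ∈ I
  rp_left : ∀ x y : A, x ∈ I → rp k x y ∈ I
  rp_right : ∀ x y : A, y ∈ I → rp k x y ∈ I

variable (L : Type v) [AddCommGroup L] [Module k L] [LeibnizAlgebra k L]

/-- The defining relations `a ⊢ b - b ⊣ a - [ab]`, `a, b ∈ L`, of `U(L)`. -/
def envRel : Set (FreeDialg k L) :=
  {X | ∃ a b : L, X = rp k (FreeDialg.of k a) (FreeDialg.of k b)
    - lp k (FreeDialg.of k b) (FreeDialg.of k a) - FreeDialg.of k (br k a b)}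

/-- The ideal of `F(L)` generated by the defining relations of `U(L)`. -/
def envIdeal : Submodule k (FreeDialg k L) :=
  sInf {I | IsDialgIdeal k I ∧ envRel k L ⊆ I}

theorem envIdeal_isDialgIdeal : IsDialgIdeal k (envIdeal k L) := by
  constructor <;> intro x y h <;> rw [envIdeal, Submodule.mem_sInf] at h ⊢ <;> intro I hI
  · exact hI.1.lp_left x y (h I hI)
  · exact hI.1.lp_right x y (h I hI)
  · exact hI.1.rp_left x y (h I hI)
  · exact hI.1.rp_right x y (h I hI)

theorem envRel_subset : envRel k L ⊆ envIdeal k L := fun x hx => by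
  rw [SetLike.mem_coe, envIdeal, Submodule.mem_sInf]
  exact fun I hI => hI.2 hx

/-- The universal enveloping associative dialgebra `U(L)` of a Leibniz algebra `L`. -/
abbrev Env : Type (max u v) := FreeDialg k L ⧸ envIdeal k L

variable {k} in
/-- A bilinear operation descends to the quotient by a subspace that absorbs it on both sides. -/
def descend {A : Type v} [AddCommGroup A] [Module k A] (I : Submodule k A)
    (m : A →ₗ[k] A →ₗ[k] A) (hl : ∀ x y, x ∈ I → m x y ∈ I) (hr : ∀ x y, y ∈ I → m x y ∈ I) :
    (A ⧸ I) →ₗ[k] (A ⧸ I) →ₗ[k] (A ⧸ I) :=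
  I.liftQ
    { toFun := fun x => I.mapQ I (m x) (fun y hy => hr x y hy)
      map_add' := fun x y => by ext z; simp
      map_smul' := fun c x => by ext z; simp }
    (fun x hx => by
      rw [LinearMap.mem_ker]
      ext y
      simpa using hl x y hx)

/-- The operations of `U(L)`, induced from `F(L)`. -/
instance instEnvDialg : AssocDialgebra k (Env k L) where
  lp := descend (envIdeal k L) AssocDialgebra.lp
    (envIdeal_isDialgIdeal k L).lp_left (envIdeal_isDialgIdeal k L).lp_right
  rp := descend (envIdeal k L) AssocDialgebra.rp
    (envIdeal_isDialgIdeal k L).rp_left (envIdeal_isDialgIdeal k L).rp_right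
  rp_bar x y z := by
    obtain ⟨x, rfl⟩ := Submodule.Quotient.mk_surjective _ x
    obtain ⟨y, rfl⟩ := Submodule.Quotient.mk_surjective _ y
    obtain ⟨z, rfl⟩ := Submodule.Quotient.mk_surjective _ z
    exact congrArg (Submodule.Quotient.mk) (AssocDialgebra.rp_bar x y z)
  lp_bar x y z := by
    obtain ⟨x, rfl⟩ := Submodule.Quotient.mk_surjective _ x
    obtain ⟨y, rfl⟩ := Submodule.Quotient.mk_surjective _ y
    obtain ⟨z, rfl⟩ := Submodule.Quotient.mk_surjective _ z
    exact congrArg (Submodule.Quotient.mk) (AssocDialgebra.lp_bar x y z)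
  lp_assoc x y z := by
    obtain ⟨x, rfl⟩ := Submodule.Quotient.mk_surjective _ x
    obtain ⟨y, rfl⟩ := Submodule.Quotient.mk_surjective _ y
    obtain ⟨z, rfl⟩ := Submodule.Quotient.mk_surjective _ z
    exact congrArg (Submodule.Quotient.mk) (AssocDialgebra.lp_assoc x y z)
  mid_assoc x y z := by
    obtain ⟨x, rfl⟩ := Submodule.Quotient.mk_surjective _ x
    obtain ⟨y, rfl⟩ := Submodule.Quotient.mk_surjective _ y
    obtain ⟨z, rfl⟩ := Submodule.Quotient.mk_surjective _ z
    exact congrArg (Submodule.Quotient.mk) (AssocDialgebra.mid_assoc x y z)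
  rp_assoc x y z := by
    obtain ⟨x, rfl⟩ := Submodule.Quotient.mk_surjective _ x
    obtain ⟨y, rfl⟩ := Submodule.Quotient.mk_surjective _ y
    obtain ⟨z, rfl⟩ := Submodule.Quotient.mk_surjective _ z
    exact congrArg (Submodule.Quotient.mk) (AssocDialgebra.rp_assoc x y z)

variable {L} in
/-- The canonical map `L → U(L)`, `c ↦ c̃`. -/
def Env.ι : L →ₗ[k] Env k L := (envIdeal k L).mkQ ∘ₗ FreeDialg.of k

variable {k L}

theorem lift_ideal_le {A : Type w} [AddCommGroup A] [Module k A] [AssocDialgebra k A]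
    (φ : LeibnizHom k L (Minus A)) :
    envIdeal k L ≤
      LinearMap.ker (FreeDialg.lift ((Minus.out k A).toLinearMap ∘ₗ φ.toLinearMap)).toLinearMap := by
  refine sInf_le ⟨⟨?_, ?_, ?_, ?_⟩, ?_⟩
  · intro x y hx
    rw [LinearMap.mem_ker] at hx ⊢
    refine (DialgHom.map_lp _ x y).trans ?_
    rw [hx]; simp [lp, rp]
  · intro x y hx
    rw [LinearMap.mem_ker] at hx ⊢
    refine (DialgHom.map_lp _ x y).trans ?_
    rw [hx]; simp [lp, rp]
  · intro x y hx
    rw [LinearMap.mem_ker] at hx ⊢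
    refine (DialgHom.map_rp _ x y).trans ?_
    rw [hx]; simp [lp, rp]
  · intro x y hx
    rw [LinearMap.mem_ker] at hx ⊢
    refine (DialgHom.map_rp _ x y).trans ?_
    rw [hx]; simp [lp, rp]
  · rintro X ⟨a, b, rfl⟩
    rw [SetLike.mem_coe, LinearMap.mem_ker, map_sub, map_sub, FreeDialg.lift_of, sub_eq_zero]
    have h1 := (FreeDialg.lift ((Minus.out k A).toLinearMap ∘ₗ φ.toLinearMap)).map_rp
      (FreeDialg.of k a) (FreeDialg.of k b)
    have h2 := (FreeDialg.lift ((Minus.out k A).toLinearMap ∘ₗ φ.toLinearMap)).map_lp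
      (FreeDialg.of k b) (FreeDialg.of k a)
    refine (congrArg₂ (· - ·) h1 h2).trans ?_
    rw [FreeDialg.lift_of, FreeDialg.lift_of]
    exact (congrArg (Minus.out k A) (φ.map_br a b)).symm

/-- The homomorphism of dialgebras `U(L) → A` induced by a homomorphism `L → A⁽⁻⁾` of Leibniz
algebras. -/
def Env.lift {A : Type w} [AddCommGroup A] [Module k A] [AssocDialgebra k A]
    (φ : LeibnizHom k L (Minus A)) : DialgHom k (Env k L) A where
  toLinearMap := (envIdeal k L).liftQ _ (lift_ideal_le φ)
  map_lp X Y := by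
    obtain ⟨X, rfl⟩ := Submodule.Quotient.mk_surjective _ X
    obtain ⟨Y, rfl⟩ := Submodule.Quotient.mk_surjective _ Y
    exact DialgHom.map_lp (FreeDialg.lift ((Minus.out k A).toLinearMap ∘ₗ φ.toLinearMap)) X Y
  map_rp X Y := by
    obtain ⟨X, rfl⟩ := Submodule.Quotient.mk_surjective _ X
    obtain ⟨Y, rfl⟩ := Submodule.Quotient.mk_surjective _ Y
    exact DialgHom.map_rp (FreeDialg.lift ((Minus.out k A).toLinearMap ∘ₗ φ.toLinearMap)) X Y

theorem Env.lift_ι {A : Type w} [AddCommGroup A] [Module k A] [AssocDialgebra k A]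
    (φ : LeibnizHom k L (Minus A)) (x : L) :
    (Env.lift φ).toLinearMap (Env.ι k x) = Minus.out k A (φ.toLinearMap x) :=
  FreeDialg.lift_of ((Minus.out k A).toLinearMap ∘ₗ φ.toLinearMap) x

end Envelope

/-! ## The Lie algebra `L^alg` -/

section LieQuotient

variable (k : Type u) (L : Type v) [CommRing k] [AddCommGroup L] [Module k L] [LeibnizAlgebra k L]

/-- The span of all `[aa]`. It contains all `[ab] + [ba]`, and it is their span as soon as `2` is
invertible; in characteristic `2` the squares `[aa]` are needed for the quotient to be a Lie
algebra. -/
def leibKer : Submodule k L := Submodule.span k (Set.range fun a : L => br k a a)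

theorem symm_mem_leibKer (a b : L) : br k a b + br k b a ∈ leibKer k L := by
  have h : br k a b + br k b a = br k (a + b) (a + b) - br k a a - br k b b := by
    simp only [br, map_add, LinearMap.add_apply]; abel
  rw [h]
  exact sub_mem (sub_mem (Submodule.subset_span ⟨_, rfl⟩) (Submodule.subset_span ⟨_, rfl⟩))
    (Submodule.subset_span ⟨_, rfl⟩)

theorem leibKer_eq_span_symm (h2 : IsUnit (2 : k)) :
    leibKer k L = Submodule.span k {x | ∃ a b : L, x = br k a b + br k b a} := by
  apply le_antisymm
  · refine Submodule.span_le.2 ?_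
    rintro _ ⟨a, rfl⟩
    obtain ⟨c, hc⟩ := h2
    have : br k a a = (↑c⁻¹ : k) • (br k a a + br k a a) := by
      rw [← two_smul k (br k a a), ← hc, smul_smul, Units.inv_mul, one_smul]
    change br k a a ∈ _
    rw [this]
    exact Submodule.smul_mem _ _ (Submodule.subset_span ⟨a, a, rfl⟩)
  · refine Submodule.span_le.2 ?_
    rintro _ ⟨a, b, rfl⟩
    exact symm_mem_leibKer k L a b

theorem leibKer_left (x y : L) (hx : x ∈ leibKer k L) : br k x y ∈ leibKer k L := by
  induction hx using Submodule.span_induction with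
  | mem x h =>
    obtain ⟨a, rfl⟩ := h
    have := LeibnizAlgebra.leibniz (k := k) a a y
    have h0 : br k (br k a a) y = 0 := by simpa using this
    change br k (br k a a) y ∈ _
    rw [h0]; exact zero_mem _
  | zero => simp [br]
  | add x y _ _ hx hy => simpa [br] using add_mem hx hy
  | smul c x _ hx => simpa [br] using Submodule.smul_mem _ c hx

theorem leibKer_right (x y : L) (hy : y ∈ leibKer k L) : br k x y ∈ leibKer k L := by
  induction hy using Submodule.span_induction with
  | mem y h =>
    obtain ⟨a, rfl⟩ := h
    have := LeibnizAlgebra.leibniz (k := k) x a a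
    change br k x (br k a a) ∈ _
    rw [show br k x (br k a a) = _ from this]
    exact symm_mem_leibKer k L _ _
  | zero => simp [br]
  | add x y _ _ hx hy => simpa [br] using add_mem hx hy
  | smul c x _ hx => simpa [br] using Submodule.smul_mem _ c hx

/-- The Lie algebra `L^alg`. -/
def LAlg : Type v := L ⧸ leibKer k L

instance : AddCommGroup (LAlg k L) := inferInstanceAs (AddCommGroup (L ⧸ leibKer k L))
instance : Module k (LAlg k L) := inferInstanceAs (Module k (L ⧸ leibKer k L))

variable {L} in
/-- The natural map `L → L^alg`, `a ↦ ā`. -/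
def toAlg : L →ₗ[k] LAlg k L := (leibKer k L).mkQ

theorem toAlg_surjective : Function.Surjective (toAlg k (L := L)) :=
  Submodule.mkQ_surjective _

/-- The bracket of `L^alg`. -/
def algBracket : LAlg k L →ₗ[k] LAlg k L →ₗ[k] LAlg k L :=
  descend (leibKer k L) LeibnizAlgebra.bracket (leibKer_left k L) (leibKer_right k L)

instance : LieRing (LAlg k L) where
  bracket x y := algBracket k L x y
  add_lie x y z := by rw [map_add]; rfl
  lie_add x y z := (algBracket k L x).map_add y z
  lie_self x := by
    obtain ⟨x, rfl⟩ := toAlg_surjective k L x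
    exact (Submodule.Quotient.mk_eq_zero _).2 (Submodule.subset_span ⟨x, rfl⟩)
  leibniz_lie x y z := by
    obtain ⟨x, rfl⟩ := toAlg_surjective k L x
    obtain ⟨y, rfl⟩ := toAlg_surjective k L y
    obtain ⟨z, rfl⟩ := toAlg_surjective k L z
    exact congrArg (toAlg k) (LeibnizAlgebra.leibniz (k := k) x y z)

instance : LieAlgebra k (LAlg k L) where
  lie_smul c x y := (algBracket k L x).map_smul c y

theorem toAlg_br (x y : L) : toAlg k (br k x y) = ⁅toAlg k x, toAlg k y⁆ := rfl

attribute [local instance] LieRing.ofAssociativeRing in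
/-- The universal enveloping algebra `U(L^alg)` as the regular left `L^alg`-module:
`x · u = x u`. -/
instance : LieRingModule (LAlg k L) (UniversalEnvelopingAlgebra k (LAlg k L)) where
  bracket x u := UniversalEnvelopingAlgebra.ι k x * u
  add_lie x y u := by rw [map_add, add_mul]
  lie_add x u v := by rw [mul_add]
  leibniz_lie x y u := by
    rw [LieHom.map_lie, LieRing.of_associative_ring_bracket]; noncomm_ring

instance : LieModule k (LAlg k L) (UniversalEnvelopingAlgebra k (LAlg k L)) where
  smul_lie c x u := by
    change UniversalEnvelopingAlgebra.ι k (c • x) * u = c • (UniversalEnvelopingAlgebra.ι k x * u)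
    rw [map_smul, smul_mul_assoc]
  lie_smul c x u := by
    change UniversalEnvelopingAlgebra.ι k x * (c • u) = c • (UniversalEnvelopingAlgebra.ι k x * u)
    rw [mul_smul_comm]

end LieQuotient

/-! ## Conformal linear maps over the Hopf algebra `H = k[T]` -/

section Conformal

variable (k : Type u) [CommRing k]

/-- The algebra `H ⊗ H` for `H = k[T]`. It is an `H`-module via the coproduct
`Δ(h) = h(T ⊗ 1 + 1 ⊗ T)`. -/
def HH : Type u := k[X] ⊗[k] k[X]

instance : CommRing (HH k) := inferInstanceAs (CommRing (k[X] ⊗[k] k[X]))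
instance : Algebra k (HH k) := inferInstanceAs (Algebra k (k[X] ⊗[k] k[X]))

variable {k} in
/-- The element `f ⊗ g` of `H ⊗ H`. -/
def HH.tmul (f g : k[X]) : HH k := (f ⊗ₜ[k] g : k[X] ⊗[k] k[X])

/-- The coproduct of `H = k[T]`. -/
def comul : k[X] →ₐ[k] HH k := Polynomial.aeval (HH.tmul Polynomial.X 1 + HH.tmul 1 Polynomial.X)

instance : Algebra k[X] (HH k) := (comul k).toRingHom.toAlgebra

instance : IsScalarTower k k[X] (HH k) :=
  IsScalarTower.of_algebraMap_eq fun c => ((comul k).commutes c).symm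

variable (M : Type v) [AddCommGroup M] [Module k M] [Module k[X] M] [IsScalarTower k k[X] M]
variable (N : Type w) [AddCommGroup N] [Module k N] [Module k[X] N] [IsScalarTower k k[X] N]

/-- The space `(H ⊗ H) ⊗_H N`. It is a module over `H ⊗ H`, which acts on the first factor by
multiplication. -/
abbrev Pseudo : Type (max u w) := HH k ⊗[k[X]] N

/-- The space `Chom(M, N)` of conformal linear maps: the `k`-linear maps
`a : M → (H ⊗ H) ⊗_H N` such that `a(hu) = (1 ⊗ h ⊗_H id) a(u)`. -/
def Chom : Submodule k (M →ₗ[k] Pseudo k N) where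
  carrier := {a | ∀ (h : k[X]) (u : M), a (h • u) = HH.tmul 1 h • a u}
  add_mem' {a b} ha hb h u := by
    rw [LinearMap.add_apply, LinearMap.add_apply, ha, hb, smul_add]
  zero_mem' h u := by simp
  smul_mem' c a ha h u := by
    rw [LinearMap.smul_apply, LinearMap.smul_apply, ha, smul_comm]

/-- `Cend M = Chom(M, M)`. -/
abbrev Cend := Chom k M M

/-- The map `ε ⊗ id : H ⊗ H → H`, `f ⊗ g ↦ f(0) g`, as a homomorphism of `k`-algebras. -/
def counitLeftAux : HH k →ₐ[k] k[X] :=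
  (Algebra.TensorProduct.lift ((Algebra.ofId k k[X]).comp (Polynomial.aeval (0 : k)))
    (AlgHom.id k k[X]) (fun _ _ => Commute.all _ _) : k[X] ⊗[k] k[X] →ₐ[k] k[X])

@[simp] theorem counitLeftAux_tmul (f g : k[X]) :
    counitLeftAux k (HH.tmul f g) = f.eval 0 • g := by
  refine (Algebra.TensorProduct.lift_tmul _ _ _ f g).trans ?_
  simp [Algebra.ofId_apply, Polynomial.smul_eq_C_mul, Polynomial.coe_aeval_eq_eval]

theorem counitLeftAux_comul (h : k[X]) : counitLeftAux k (comul k h) = h := by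
  have : (counitLeftAux k).comp (comul k) = AlgHom.id k k[X] := by
    apply Polynomial.algHom_ext
    rw [AlgHom.comp_apply, comul, Polynomial.aeval_X, map_add, counitLeftAux_tmul,
      counitLeftAux_tmul]
    simp
  exact DFunLike.congr_fun this h

/-- The map `ε ⊗ id : H ⊗ H → H`, `f ⊗ g ↦ f(0) g`. It is `H`-linear. -/
def counitLeft : HH k →ₐ[k[X]] k[X] where
  toRingHom := (counitLeftAux k).toRingHom
  commutes' h := counitLeftAux_comul k h

theorem counitLeft_tmul (f g : k[X]) :
    counitLeft k (HH.tmul f g) = f.eval 0 • g := counitLeftAux_tmul k f g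

/-- The map `ε ⊗ id ⊗_H id : (H ⊗ H) ⊗_H N → N`, which sends `∑ hᵢ ⊗ 1 ⊗_H wᵢ` to
`∑ hᵢ(0) wᵢ`. -/
def evalZero : Pseudo k N →ₗ[k[X]] N :=
  (TensorProduct.lid k[X] N).toLinearMap ∘ₗ LinearMap.rTensor N (counitLeft k).toLinearMap

theorem evalZero_tmul (F : HH k) (w : N) : evalZero k N (F ⊗ₜ w) = counitLeft k F • w := rfl

theorem evalZero_smul (h : k[X]) (p : Pseudo k N) :
    evalZero k N (HH.tmul 1 h • p) = h • evalZero k N p := by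
  induction p using TensorProduct.induction_on with
  | zero => simp
  | add p q hp hq => rw [smul_add, map_add, map_add, hp, hq, smul_add]
  | tmul F w =>
    rw [TensorProduct.smul_tmul', evalZero_tmul, evalZero_tmul, smul_eq_mul, map_mul,
      counitLeft_tmul, mul_smul]
    simp

variable {k M N}

/-- The operation `u ↦ (a ∘₀ u)`, where `(a ∘₀ u) = ∑ hᵢ(0) wᵢ` for
`a(u) = ∑ hᵢ ⊗ 1 ⊗_H wᵢ`. It is `H`-linear. -/
def zeroAct : Chom k M N →ₗ[k] (M →ₗ[k[X]] N) where
  toFun a :=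
    { toFun := fun u => evalZero k N (a.1 u)
      map_add' := fun u v => by rw [map_add, map_add]
      map_smul' := fun h u => by rw [a.2, evalZero_smul, RingHom.id_apply] }
  map_add' a b := by ext u; simp
  map_smul' c a := by
    ext u
    change evalZero k N (c • a.1 u) = c • evalZero k N (a.1 u)
    rw [← algebraMap_smul k[X] c, map_smul, algebraMap_smul]

theorem zeroAct_apply (a : Chom k M N) (u : M) : zeroAct a u = evalZero k N (a.1 u) := rfl

theorem lTensor_smul (f : M →ₗ[k[X]] N) (F : HH k) (p : Pseudo k M) :
    LinearMap.lTensor (HH k) f (F • p) = F • LinearMap.lTensor (HH k) f p := by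
  induction p using TensorProduct.induction_on with
  | zero => simp
  | add p q hp hq => rw [smul_add, map_add, map_add, hp, hq, smul_add]
  | tmul G w => rfl

theorem evalZero_lTensor (f : M →ₗ[k[X]] N) (p : Pseudo k M) :
    evalZero k N (LinearMap.lTensor (HH k) f p) = f (evalZero k M p) := by
  induction p using TensorProduct.induction_on with
  | zero => simp
  | add p q hp hq => rw [map_add, map_add, map_add, map_add, hp, hq]
  | tmul G w => rw [LinearMap.lTensor_tmul, evalZero_tmul, evalZero_tmul, map_smul]

/-- The operation `a ⊢ b = (a ∘₀ b)` on `Cend M`: if `b(u) = ∑ hᵢ ⊗ 1 ⊗_H vᵢ` and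
`a(vᵢ) = ∑ hⱼ ⊗ 1 ⊗_H wᵢⱼ`, then `(a ∘₀ b)(u) = ∑ hⱼ(0) hᵢ ⊗ 1 ⊗_H wᵢⱼ`; in other words,
`(a ∘₀ b)(u) = ∑ hᵢ ⊗ 1 ⊗_H (a ∘₀ vᵢ)`. -/
def cendRp : Cend k M →ₗ[k] Cend k M →ₗ[k] Cend k M :=
  LinearMap.mk₂ k
    (fun a b => ⟨(LinearMap.lTensor (HH k) (zeroAct a)).restrictScalars k ∘ₗ b.1, fun h u => by
      change LinearMap.lTensor (HH k) (zeroAct a) (b.1 (h • u)) =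
        HH.tmul 1 h • LinearMap.lTensor (HH k) (zeroAct a) (b.1 u)
      rw [b.2, lTensor_smul]⟩)
    (fun a a' b => by
      ext u
      change LinearMap.lTensor (HH k) (zeroAct (a + a')) (b.1 u) = _
      rw [map_add, LinearMap.lTensor_add]; rfl)
    (fun c a b => by
      ext u
      change LinearMap.lTensor (HH k) (zeroAct (c • a)) (b.1 u) =
        c • LinearMap.lTensor (HH k) (zeroAct a) (b.1 u)
      rw [map_smul, ← algebraMap_smul k[X] c (zeroAct a), LinearMap.lTensor_smul,
        LinearMap.smul_apply, algebraMap_smul])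
    (fun a b b' => by
      ext u
      change LinearMap.lTensor (HH k) (zeroAct a) (b.1 u + b'.1 u) = _
      rw [map_add]; rfl)
    (fun c a b => by
      ext u
      change LinearMap.lTensor (HH k) (zeroAct a) (c • b.1 u) =
        c • LinearMap.lTensor (HH k) (zeroAct a) (b.1 u)
      rw [← algebraMap_smul k[X] c (b.1 u), map_smul, algebraMap_smul])

/-- The operation `a ⊣ b = {a ∘₀ b}` on `Cend M`: in the same notation
`{a ∘₀ b}(u) = ∑ hᵢ(0) hⱼ ⊗ 1 ⊗_H wᵢⱼ`; in other words, `{a ∘₀ b}(u) = a(b ∘₀ u)`. -/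
def cendLp : Cend k M →ₗ[k] Cend k M →ₗ[k] Cend k M :=
  LinearMap.mk₂ k
    (fun a b => ⟨a.1 ∘ₗ (zeroAct b).restrictScalars k, fun h u => by
      change a.1 (zeroAct b (h • u)) = HH.tmul 1 h • a.1 (zeroAct b u)
      rw [map_smul, a.2]⟩)
    (fun a a' b => rfl)
    (fun c a b => rfl)
    (fun a b b' => by
      ext u
      change a.1 (zeroAct (b + b') u) = _
      rw [map_add, LinearMap.add_apply, map_add]; rfl)
    (fun c a b => by
      ext u
      change a.1 (zeroAct (c • b) u) = c • a.1 (zeroAct b u)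
      rw [map_smul, LinearMap.smul_apply, map_smul])

theorem cendRp_apply (a b : Cend k M) (u : M) :
    (cendRp a b).1 u = LinearMap.lTensor (HH k) (zeroAct a) (b.1 u) := rfl

theorem cendLp_apply (a b : Cend k M) (u : M) :
    (cendLp a b).1 u = a.1 (zeroAct b u) := rfl

theorem zeroAct_cendRp (a b : Cend k M) : zeroAct (cendRp a b) = zeroAct a ∘ₗ zeroAct b := by
  ext u
  rw [zeroAct_apply, cendRp_apply, evalZero_lTensor]; rfl

theorem zeroAct_cendLp (a b : Cend k M) : zeroAct (cendLp a b) = zeroAct a ∘ₗ zeroAct b := rfl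

/-- The associative dialgebra `Cend M⁽⁰⁾`. -/
instance instCendDialg : AssocDialgebra k (Cend k M) where
  lp := cendLp
  rp := cendRp
  rp_bar a b c := by
    ext u; rw [cendRp_apply, cendRp_apply, zeroAct_cendRp, zeroAct_cendLp]
  lp_bar a b c := by
    ext u; rw [cendLp_apply, cendLp_apply, zeroAct_cendRp, zeroAct_cendLp]
  lp_assoc a b c := rfl
  mid_assoc a b c := rfl
  rp_assoc a b c := by
    ext u
    rw [cendRp_apply, cendRp_apply, cendRp_apply, zeroAct_cendRp, LinearMap.lTensor_comp]; rfl

variable (k M) in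
/-- The adjoint Leibniz algebra `gc M⁽⁰⁾` of `Cend M⁽⁰⁾`. -/
abbrev Gc := Minus (Cend k M)

variable (k) in
/-- A conformal representation of a Leibniz algebra `L` on an `H`-module `M`: a homomorphism
`L → gc M⁽⁰⁾`. -/
abbrev ConformalRep (L : Type v) [AddCommGroup L] [Module k L] [LeibnizAlgebra k L]
    (M : Type w) [AddCommGroup M] [Module k M] [Module k[X] M] [IsScalarTower k k[X] M] :=
  LeibnizHom k L (Gc k M)

/-- The representation `U(ρ) : U(L) → Cend M⁽⁰⁾` of the dialgebra `U(L)` induced by a conformal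
representation `ρ` of `L`. It extends `ρ`. -/
def envRep {L : Type v} [AddCommGroup L] [Module k L] [LeibnizAlgebra k L]
    {M : Type w} [AddCommGroup M] [Module k M] [Module k[X] M] [IsScalarTower k k[X] M]
    (ρ : ConformalRep k L M) : DialgHom k (Env k L) (Cend k M) :=
  Env.lift ρ

end Conformal

section FreeModule

variable (k : Type u) [CommRing k]
variable {M₀ : Type v} [AddCommGroup M₀] [Module k M₀]
variable {N : Type w} [AddCommGroup N] [Module k N] [Module k[X] N] [IsScalarTower k k[X] N]

/-- The conformal linear map `H ⊗ M₀ → N` with prescribed values `φ(u) ∈ (H ⊗ H) ⊗_H N` on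
`M₀`: `h ⊗ u ↦ (1 ⊗ h ⊗_H id) φ(u)`. -/
def Chom.extend : (M₀ →ₗ[k] Pseudo k N) →ₗ[k] Chom k (k[X] ⊗[k] M₀) N where
  toFun φ := ⟨TensorProduct.lift
    (LinearMap.mk₂ k (fun (h : k[X]) (u : M₀) => HH.tmul 1 h • φ u)
      (fun h h' u => by
        rw [← add_smul]; congr 1; exact TensorProduct.tmul_add _ _ _)
      (fun c h u => by
        rw [← smul_assoc]; congr 1; exact TensorProduct.tmul_smul _ _ _)
      (fun h u u' => by rw [map_add, smul_add])
      (fun c h u => by rw [map_smul, smul_comm])), fun h x => by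
    induction x using TensorProduct.induction_on with
    | zero => simp
    | add x y hx hy => rw [smul_add, map_add, map_add, hx, hy, smul_add]
    | tmul g u =>
      rw [TensorProduct.smul_tmul', TensorProduct.lift.tmul, TensorProduct.lift.tmul]
      change HH.tmul 1 (h • g) • φ u = HH.tmul 1 h • HH.tmul 1 g • φ u
      rw [smul_smul]
      congr 1
      change _ = ((1 : k[X]) ⊗ₜ[k] h : k[X] ⊗[k] k[X]) * ((1 : k[X]) ⊗ₜ[k] g)
      rw [Algebra.TensorProduct.tmul_mul_tmul, one_mul]; rfl⟩
  map_add' φ ψ := by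
    apply Subtype.ext
    apply TensorProduct.ext'
    intro h u
    change HH.tmul 1 h • (φ u + ψ u) = HH.tmul 1 h • φ u + HH.tmul 1 h • ψ u
    rw [smul_add]
  map_smul' c φ := by
    apply Subtype.ext
    apply TensorProduct.ext'
    intro h u
    change HH.tmul 1 h • (c • φ u) = c • HH.tmul 1 h • φ u
    rw [smul_comm]

theorem Chom.extend_tmul (φ : M₀ →ₗ[k] Pseudo k N) (h : k[X]) (u : M₀) :
    (Chom.extend k φ).1 (h ⊗ₜ u) = HH.tmul 1 h • φ u := rfl

end FreeModule

/-! ## The conformal representation of a Leibniz algebra -/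

section Rep

variable (k : Type u) (L : Type v) [CommRing k] [AddCommGroup L] [Module k L] [LeibnizAlgebra k L]
variable (V : Type w) [AddCommGroup V] [Module k V]
  [LieRingModule (LAlg k L) V] [LieModule k (LAlg k L) V]

/-- `M₀ = V ⊕ (L ⊗ V)`. -/
abbrev BaseSpace := V × (L ⊗[k] V)

/-- `M = H ⊗ M₀`. -/
abbrev RepModule := k[X] ⊗[k] BaseSpace k L V

/-- The action of `L` on `V` through `L^alg`. -/
def actV : L →ₗ[k] Module.End k V :=
  LinearMap.mk₂ k (fun a v => ⁅toAlg k a, v⁆)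
    (fun a b v => by rw [map_add, add_lie])
    (fun c a v => by rw [map_smul, smul_lie])
    (fun a v w => by rw [lie_add])
    (fun c a v => by rw [lie_smul])

theorem actV_br (a b : L) (v : V) :
    actV k L V (br k a b) v
      = actV k L V a (actV k L V b v) - actV k L V b (actV k L V a v) := by
  change ⁅toAlg k (br k a b), v⁆ = ⁅toAlg k a, ⁅toAlg k b, v⁆⁆ - ⁅toAlg k b, ⁅toAlg k a, v⁆⁆
  rw [toAlg_br, lie_lie]

/-- The map `a₀`: `v ↦ ā v`, `b ⊗ v ↦ b ⊗ ā v + [ab] ⊗ v`. -/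
def coeff₀ : L →ₗ[k] Module.End k (BaseSpace k L V) :=
  LinearMap.prodMapLinear k V (L ⊗[k] V) V (L ⊗[k] V) k ∘ₗ
    (actV k L V).prod
      (LinearMap.lTensorHom L ∘ₗ actV k L V +
        LinearMap.rTensorHom V ∘ₗ LeibnizAlgebra.bracket)

/-- The map `a₁`: `v ↦ a ⊗ v`, `b ⊗ v ↦ 0`. -/
def coeff₁ : L →ₗ[k] Module.End k (BaseSpace k L V) :=
  LinearMap.mk₂ k (fun a p => ((0 : V), a ⊗ₜ[k] p.1))
    (fun a b p => by simp [TensorProduct.add_tmul])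
    (fun c a p => by simp [TensorProduct.smul_tmul'])
    (fun a p q => by simp [TensorProduct.tmul_add])
    (fun c a p => by simp)

variable {k L V}

theorem coeff₀_inl (a : L) (v : V) :
    coeff₀ k L V a (v, 0) = (⁅toAlg k a, v⁆, 0) := by
  simp [coeff₀, actV]

theorem coeff₀_inr (a b : L) (v : V) :
    coeff₀ k L V a (0, b ⊗ₜ v) = (0, b ⊗ₜ ⁅toAlg k a, v⁆ + br k a b ⊗ₜ v) := by
  simp [coeff₀, actV]

theorem coeff₁_apply (a : L) (v : V) (x : L ⊗[k] V) :
    coeff₁ k L V a (v, x) = (0, a ⊗ₜ v) := rfl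

theorem base_ext {A : Type*} [AddCommGroup A] [Module k A] {f g : BaseSpace k L V →ₗ[k] A}
    (h1 : ∀ v, f (v, 0) = g (v, 0)) (h2 : ∀ b v, f (0, b ⊗ₜ v) = g (0, b ⊗ₜ v)) : f = g := by
  apply LinearMap.prod_ext
  · ext v; exact h1 v
  · apply TensorProduct.ext'
    exact h2

theorem coeff₀_br (a b : L) (p : BaseSpace k L V) :
    coeff₀ k L V (br k a b) p
      = coeff₀ k L V a (coeff₀ k L V b p) - coeff₀ k L V b (coeff₀ k L V a p) := by
  have : coeff₀ k L V (br k a b)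
      = coeff₀ k L V a ∘ₗ coeff₀ k L V b - coeff₀ k L V b ∘ₗ coeff₀ k L V a := by
    apply base_ext
    · intro v
      simp [coeff₀_inl, toAlg_br]
    · intro c v
      have hp : ∀ x y : L ⊗[k] V, ((0, x + y) : BaseSpace k L V) = (0, x) + (0, y) := by simp
      simp only [LinearMap.sub_apply, LinearMap.comp_apply, coeff₀_inr, hp, map_add, toAlg_br,
        lie_lie, TensorProduct.tmul_sub]
      have hl : br k a (br k b c) = br k (br k a b) c + br k b (br k a c) :=
        LeibnizAlgebra.leibniz a b c
      rw [hl, TensorProduct.add_tmul]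
      simp only [Prod.mk_add_mk, Prod.mk_sub_mk, add_zero, sub_zero]
      congr 1
      abel
  rw [this]; rfl

theorem coeff₁_br (a b : L) (p : BaseSpace k L V) :
    coeff₁ k L V (br k a b) p
      = coeff₀ k L V a (coeff₁ k L V b p) - coeff₁ k L V b (coeff₀ k L V a p) := by
  obtain ⟨v, x⟩ := p
  rw [coeff₁_apply, coeff₁_apply, coeff₀_inr]
  have : (coeff₀ k L V a (v, x)).1 = ⁅toAlg k a, v⁆ := by simp [coeff₀, actV]
  have h2 : coeff₁ k L V b (coeff₀ k L V a (v, x)) = (0, b ⊗ₜ ⁅toAlg k a, v⁆) := by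
    rw [← this]; rfl
  rw [h2]; simp

variable (k L V)

/-- The values on `M₀` of the conformal linear map `ρ(a) = 1 ⊗ a₀ - T ⊗ a₁`, that is,
`ρ(a)(u) = 1 ⊗ 1 ⊗_H a₀ u - T ⊗ 1 ⊗_H a₁ u`. In terms of the operations
`(· ∘_z ·)`, where `∑ hᵢ ⊗ 1 ⊗_H wᵢ` is evaluated to `∑ hᵢ(-z) wᵢ`, this reads
`ρ(a) ∘_z v = ā v + z (a ⊗ v)` and `ρ(a) ∘_z (b ⊗ v) = b ⊗ ā v + [ab] ⊗ v`. -/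
def repValues : L →ₗ[k] BaseSpace k L V →ₗ[k] Pseudo k (RepModule k L V) :=
  LinearMap.mk₂ k
    (fun a u =>
      (HH.tmul 1 1 ⊗ₜ[k[X]] ((1 : k[X]) ⊗ₜ[k] coeff₀ k L V a u) : Pseudo k (RepModule k L V))
      - HH.tmul Polynomial.X 1 ⊗ₜ[k[X]] ((1 : k[X]) ⊗ₜ[k] coeff₁ k L V a u))
    (fun a b u => by
      simp only [map_add, LinearMap.add_apply, TensorProduct.tmul_add]; abel)
    (fun c a u => by
      simp only [map_smul, LinearMap.smul_apply, TensorProduct.tmul_smul, smul_sub])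
    (fun a u v => by
      simp only [map_add, TensorProduct.tmul_add]; abel)
    (fun c a u => by
      simp only [map_smul, TensorProduct.tmul_smul, smul_sub])

/-- The linear map `ρ : L → Cend M`. -/
def repLin : L →ₗ[k] Cend k (RepModule k L V) :=
  Chom.extend k ∘ₗ repValues k L V

theorem repLin_tmul (a : L) (u : BaseSpace k L V) :
    (repLin k L V a).1 ((1 : k[X]) ⊗ₜ u) =
      (HH.tmul 1 1 ⊗ₜ[k[X]] ((1 : k[X]) ⊗ₜ[k] coeff₀ k L V a u) : Pseudo k (RepModule k L V))
      - HH.tmul Polynomial.X 1 ⊗ₜ[k[X]] ((1 : k[X]) ⊗ₜ[k] coeff₁ k L V a u) := by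
  change (HH.tmul (1 : k[X]) 1 : HH k) • repValues k L V a u = _
  have : (HH.tmul (1 : k[X]) 1 : HH k) = 1 := rfl
  rw [this, one_smul]; rfl

theorem zeroAct_repLin (a : L) (u : BaseSpace k L V) :
    zeroAct (repLin k L V a) ((1 : k[X]) ⊗ₜ u) = (1 : k[X]) ⊗ₜ coeff₀ k L V a u := by
  rw [zeroAct_apply, repLin_tmul, map_sub, evalZero_tmul, evalZero_tmul, counitLeft_tmul,
    counitLeft_tmul]
  simp

theorem cend_ext {a b : Cend k (RepModule k L V)}
    (h : ∀ u, a.1 ((1 : k[X]) ⊗ₜ u) = b.1 ((1 : k[X]) ⊗ₜ u)) : a = b := by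
  apply Subtype.ext
  apply TensorProduct.ext'
  intro g u
  have : (g ⊗ₜ[k] u : RepModule k L V) = g • ((1 : k[X]) ⊗ₜ[k] u) := by
    rw [TensorProduct.smul_tmul', smul_eq_mul, mul_one]
  rw [this, a.2, b.2, h]

/-- The conformal representation `ρ` of `L` on `M = H ⊗ (V ⊕ (L ⊗ V))` built on an
`L^alg`-module `V`. -/
def rep : ConformalRep k L (RepModule k L V) where
  toLinearMap := repLin k L V
  map_br a b := by
    change repLin k L V (br k a b) =
      cendRp (repLin k L V a) (repLin k L V b) - cendLp (repLin k L V b) (repLin k L V a)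
    apply cend_ext
    intro u
    rw [AddSubgroupClass.coe_sub, LinearMap.sub_apply, cendRp_apply, cendLp_apply, zeroAct_repLin,
      repLin_tmul, repLin_tmul, repLin_tmul, map_sub, LinearMap.lTensor_tmul,
      LinearMap.lTensor_tmul, zeroAct_repLin, zeroAct_repLin, coeff₀_br, coeff₁_br]
    simp only [TensorProduct.tmul_sub]
    abel

/-- The conformal representation `ρ_U`, built on the regular module `V = U(L^alg)`. -/
def repU : ConformalRep k L (RepModule k L (UniversalEnvelopingAlgebra k (LAlg k L))) :=
  rep k L (UniversalEnvelopingAlgebra k (LAlg k L))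

variable {L} in
/-- The word `c̃ ⊣ ã_{i₁} ⊣ ⋯ ⊣ ã_{iₙ}` in `U(L)`, bracketed from the left. -/
def envWord {I : Type*} (c : L) (a : I → L) (l : List I) : Env k L :=
  l.foldl (fun x i => lp k x (Env.ι k (a i))) (Env.ι k c)

end Rep

end ConfLeibniz

end

/-! The proof compares $U(L)$ with $L\otimes U(L^{\mathrm{alg}})$. In a dialgebra everything to the
right of $\dashv$ may be multiplied with either operation, so $x\mapsto x\dashv\tilde a$ turns
brackets of $L$ into reversed commutators. It therefore kills every $[aa]$, and $U(L)$ becomes a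
right $U(L^{\mathrm{alg}})$-module. The map $c\otimes u\mapsto\tilde c\dashv u$ (`envOfTensor`) is
onto: its range contains the generators, is closed under $\dashv\tilde a$, and is closed under
$\tilde a\vdash$ because $\tilde a\vdash\tilde c=\tilde c\dashv\tilde a+\widetilde{[ac]}$.

Conversely, $\tilde c\dashv u$ acts on $1\in V$ as $\rho_U(c)$ acts on $u$, giving
$1\otimes1\otimes_H\bar c u-T\otimes1\otimes_H(c\otimes u)$. The coefficient of $T$ returns
$c\otimes u$ up to sign, so `recover` is a left inverse of $U(\rho_U)$ composed with `envOfTensor`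
(`recover_envRep_envOfTensor`). A surjection followed by $U(\rho_U)$ is thus injective, which makes
`envOfTensor` bijective and $U(\rho_U)$ faithful.

The words in the statement are the images of $c\otimes a_{i_1}\cdots a_{i_n}$, so the second claim
needs that ordered monomials form a basis of $U(L^{\mathrm{alg}})$, the Poincaré-Birkhoff-Witt
theorem. Its independence half lets the Lie algebra act on polynomials so that an ordered monomial
sends $1$ to the corresponding commutative monomial; the commutation relation is checked by
induction on degree, with the Jacobi identity in the essential case (`comm_basis`). Its spanning
half sorts words modulo shorter ones (`monomial_sub_mem`). -/

noncomputable section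

/-! ### Poincaré-Birkhoff-Witt: the Lie algebra acts on polynomials. -/

namespace PBW

open Finsupp

variable {k : Type*} [Field k] {g : Type*} [LieRing g] [LieAlgebra k g]
variable {I : Type*} [LinearOrder I]

/-- `m` is `j ::ₘ m'` with `j` a lower bound of `m'` and `j < i`. -/
def Splits (i : I) (m : Multiset I) (p : I × Multiset I) : Prop :=
  m = p.1 ::ₘ p.2 ∧ (∀ x ∈ p.2, p.1 ≤ x) ∧ p.1 < i

/-- The split-off letter is the least element of `m`, so the choice made in `act` is no choice at
all. -/
theorem Splits.unique {i : I} {m : Multiset I} {p q : I × Multiset I} (hp : Splits i m p)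
    (hq : Splits i m q) : p = q := by
  obtain ⟨j, s⟩ := p
  obtain ⟨l, t⟩ := q
  obtain ⟨h1, h2, -⟩ := hp
  obtain ⟨h3, h4, -⟩ := hq
  simp only at h1 h2 h3 h4
  have hlj : l ≤ j := by
    have : j ∈ l ::ₘ t := by rw [← h3, h1]; exact Multiset.mem_cons_self _ _
    rcases Multiset.mem_cons.1 this with h | h
    · exact h.ge
    · exact h4 _ h
  have hjl : j ≤ l := by
    have : l ∈ j ::ₘ s := by rw [← h1, h3]; exact Multiset.mem_cons_self _ _
    rcases Multiset.mem_cons.1 this with h | h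
    · exact h.ge
    · exact h2 _ h
  obtain rfl := le_antisymm hlj hjl
  rw [h1] at h3
  rw [Multiset.cons_inj_right] at h3
  rw [h3]

theorem exists_min_cons (m : Multiset I) (hm : m ≠ 0) :
    ∃ j s, m = j ::ₘ s ∧ ∀ x ∈ s, j ≤ x := by
  obtain ⟨j, hj, hmin⟩ := m.toFinset.exists_min_image id (by simpa using hm)
  refine ⟨j, m.erase j, (Multiset.cons_erase (by simpa using hj)).symm, fun x hx => ?_⟩
  exact hmin x (by simpa using Multiset.mem_of_mem_erase hx)

open Classical in
/-- The action on monomials of degree at most `n`, by recursion on `n`. -/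
def act (A : Module.Basis I k g) : ℕ → g →ₗ[k] (Multiset I →₀ k) →ₗ[k] (Multiset I →₀ k)
  | 0 => A.constr k fun i => linearCombination k fun m => single (i ::ₘ m) 1
  | n + 1 => A.constr k fun i => linearCombination k fun m =>
      -- With $m=jm'$, the module law forces $i(jm')=j(i\,m')+[i,j]m'$. Write $i\,m'$ as the
      -- monomial $im'$ plus a remainder of lower degree; since $j$ is least, it sends the monomial
      -- $im'$ to the monomial $im$. What is left involves only degrees below that of $m$.
      if h : ∃ p, Splits i m p then
        single (i ::ₘ m) 1 + act A n (A h.choose.1)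
          (act A n (A i) (single h.choose.2 1) - single (i ::ₘ h.choose.2) 1)
        + act A n ⁅A i, A h.choose.1⁆ (single h.choose.2 1)
      else single (i ::ₘ m) 1

variable (A : Module.Basis I k g)

theorem act_zero (i : I) (m : Multiset I) :
    act A 0 (A i) (single m 1) = single (i ::ₘ m) 1 := by
  simp [act]

theorem act_succ_of_not (n : ℕ) (i : I) (m : Multiset I) (h : ¬ ∃ p, Splits i m p) :
    act A (n + 1) (A i) (single m 1) = single (i ::ₘ m) 1 := by
  simp [act, h]

theorem act_succ_of_splits (n : ℕ) (i : I) (m : Multiset I) (p : I × Multiset I)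
    (h : Splits i m p) :
    act A (n + 1) (A i) (single m 1) = single (i ::ₘ m) 1 +
      act A n (A p.1) (act A n (A i) (single p.2 1) - single (i ::ₘ p.2) 1)
        + act A n ⁅A i, A p.1⁆ (single p.2 1) := by
  have hex : ∃ p, Splits i m p := ⟨p, h⟩
  have : hex.choose = p := hex.choose_spec.unique h
  rw [act, Module.Basis.constr_basis, linearCombination_single, one_smul, dif_pos hex, this]

/-- The polynomials of degree at most `n`. -/
abbrev degLE (k : Type*) [Field k] (I : Type*) (n : ℕ) : Submodule k (Multiset I →₀ k) :=
  supported k k {m | m.card ≤ n}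

theorem single_mem {m : Multiset I} {n : ℕ} (h : m.card ≤ n) :
    (single m 1 : Multiset I →₀ k) ∈ degLE k I n :=
  single_mem_supported k _ h

theorem degLE_mono {m n : ℕ} (h : m ≤ n) : degLE k I m ≤ degLE k I n :=
  supported_mono fun _ hx => le_trans hx h

/-- To check a linear condition on `g × degLE n`, check it on the bases. -/
theorem forall_degLE {F : Type*} [AddCommGroup F] [Module k F]
    {f f' : g →ₗ[k] (Multiset I →₀ k) →ₗ[k] F} {n : ℕ}
    (h : ∀ i m, Multiset.card m ≤ n → f (A i) (single m 1) = f' (A i) (single m 1))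
    (x : g) {p : Multiset I →₀ k} (hp : p ∈ degLE k I n) : f x p = f' x p := by
  have key : ∀ m, Multiset.card m ≤ n → f.flip (single m 1) = f'.flip (single m 1) := fun m hm =>
    A.ext fun i => h i m hm
  rw [degLE, supported_eq_span_single] at hp
  induction hp using Submodule.span_induction with
  | mem y hy => obtain ⟨m, hm, rfl⟩ := hy; exact DFunLike.congr_fun (key m hm) x
  | zero => simp
  | add y z _ _ hy hz => rw [map_add, map_add, hy, hz]
  | smul c y _ hy => rw [map_smul, map_smul, hy]

theorem mem_of_basis {f : g →ₗ[k] (Multiset I →₀ k) →ₗ[k] (Multiset I →₀ k)} {n : ℕ}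
    {S : Submodule k (Multiset I →₀ k)}
    (h : ∀ i m, Multiset.card m ≤ n → f (A i) (single m 1) ∈ S)
    (x : g) {p : Multiset I →₀ k} (hp : p ∈ degLE k I n) : f x p ∈ S := by
  have := forall_degLE A (f := f.compr₂ S.mkQ) (f' := 0) (n := n)
    (fun i m hm => by simpa using h i m hm) x hp
  simpa using this

/-- The correction terms in the recursion apply one more element to polynomials of degree $|m|-1$,
and each application raises the degree by at most one. No bound on $|m|$ in terms of `n` is needed.
-/
theorem act_mem_aux (n : ℕ) : ∀ (i : I) (m : Multiset I),
    act A n (A i) (single m 1) - single (i ::ₘ m) 1 ∈ degLE k I m.card := by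
  induction n with
  | zero => intro i m; rw [act_zero, sub_self]; exact zero_mem _
  | succ n ih =>
    have up : ∀ (d : ℕ) (x : g) (p : Multiset I →₀ k), p ∈ degLE k I d →
        act A n x p ∈ degLE k I (d + 1) := fun d x p hp =>
      mem_of_basis A (fun i m hm => by
        rw [← sub_add_cancel (act A n (A i) (single m 1)) (single (i ::ₘ m) 1)]
        exact add_mem (degLE_mono (by omega) (ih i m)) (single_mem (by simpa using hm))) x hp
    intro i m
    by_cases h : ∃ p, Splits i m p
    · obtain ⟨p, hp⟩ := h
      have hc : m.card = p.2.card + 1 := by rw [hp.1, Multiset.card_cons]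
      rw [act_succ_of_splits A n i m p hp, add_assoc, add_sub_cancel_left, hc]
      exact add_mem (up _ _ _ (ih _ _)) (up _ _ _ (single_mem le_rfl))
    · rw [act_succ_of_not A n i m h, sub_self]; exact zero_mem _

/-- The recursion calls the previous level only in smaller degree, where the levels agree by
induction; for the remainder $i\,m'-im'$ this rests on `act_mem_aux`. Hence the levels glue to
`polyAct`. -/
theorem act_stable (n : ℕ) : ∀ (x : g) (p : Multiset I →₀ k), p ∈ degLE k I n →
    act A (n + 1) x p = act A n x p := by
  induction n with
  | zero =>
    refine fun x p hp => forall_degLE A (fun i m hm => ?_) x hp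
    rw [act_zero, act_succ_of_not]
    rintro ⟨p, hp, -⟩
    rw [hp, Multiset.card_cons] at hm
    omega
  | succ n ih =>
    refine fun x p hp => forall_degLE A (fun i m hm => ?_) x hp
    by_cases h : ∃ p, Splits i m p
    · obtain ⟨p, hp⟩ := h
      have hc : p.2.card ≤ n := by rw [hp.1, Multiset.card_cons] at hm; omega
      rw [act_succ_of_splits A _ i m p hp, act_succ_of_splits A _ i m p hp,
        ih _ _ (single_mem hc), ih _ _ (single_mem hc), ih]
      exact degLE_mono hc (act_mem_aux A n _ _)
    · rw [act_succ_of_not A _ i m h, act_succ_of_not A _ i m h]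

theorem act_of_le {n d : ℕ} (h : n ≤ d) (x : g) {p : Multiset I →₀ k} (hp : p ∈ degLE k I n) :
    act A d x p = act A n x p := by
  induction d, h using Nat.le_induction with
  | base => rfl
  | succ d hd ih => rw [act_stable A d x p (degLE_mono hd hp), ih]

/-- The action of `g` on the polynomials in the elements of a basis. -/
def polyAct : g →ₗ[k] Module.End k (Multiset I →₀ k) :=
  (linearCombination k fun m : Multiset I => (act A m.card).flip (single m 1)).flip

theorem polyAct_single (x : g) (m : Multiset I) :
    polyAct A x (single m 1) = act A m.card x (single m 1) := by
  simp [polyAct]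

theorem polyAct_eq {n : ℕ} (x : g) {p : Multiset I →₀ k} (hp : p ∈ degLE k I n) :
    polyAct A x p = act A n x p :=
  forall_degLE A (f := polyAct A) (fun i m hm => by
    rw [polyAct_single, act_of_le A hm _ (single_mem le_rfl)]) x hp

theorem polyAct_sub_mem (i : I) (m : Multiset I) :
    polyAct A (A i) (single m 1) - single (i ::ₘ m) 1 ∈ degLE k I m.card := by
  rw [polyAct_single]; exact act_mem_aux A _ i m

theorem polyAct_of_le (i : I) (m : Multiset I) (h : ∀ x ∈ m, i ≤ x) :
    polyAct A (A i) (single m 1) = single (i ::ₘ m) 1 := by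
  rw [polyAct_single]
  cases hc : m.card with
  | zero => rw [act_zero]
  | succ n =>
    rw [act_succ_of_not]
    rintro ⟨p, hp, -, hlt⟩
    exact (h p.1 (by rw [hp]; exact Multiset.mem_cons_self _ _)).not_gt hlt

/-- `x y p = y x p + [x y] p`. -/
def Comm (x y : g) (p : Multiset I →₀ k) : Prop :=
  polyAct A x (polyAct A y p) = polyAct A y (polyAct A x p) + polyAct A ⁅x, y⁆ p

theorem Comm.symm {x y : g} {p : Multiset I →₀ k} (h : Comm A x y p) : Comm A y x p := by
  unfold Comm at h ⊢
  rw [h, ← lie_skew y x, map_neg, LinearMap.neg_apply, add_neg_cancel_right]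

/-- This is the defining recursion read backwards: $j$ is least in $jm$ and in $im$, so it acts on
$m$ and on $im$ by plain multiplication. -/
theorem comm_of_lt {i j : I} (hij : j < i) (m : Multiset I) (h : ∀ x ∈ m, j ≤ x) :
    Comm A (A i) (A j) (single m 1) := by
  unfold Comm
  rw [polyAct_of_le A j m h, polyAct_single A (A i) (j ::ₘ m), Multiset.card_cons,
    act_succ_of_splits A m.card i (j ::ₘ m) (j, m) ⟨rfl, h, hij⟩]
  simp only
  rw [← polyAct_eq A (A i) (single_mem le_rfl), ← polyAct_eq A (A j) (polyAct_sub_mem A i m),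
    ← polyAct_eq A _ (single_mem le_rfl), map_sub, polyAct_of_le A j (i ::ₘ m),
    Multiset.cons_swap]
  · abel
  · intro x hx
    rcases Multiset.mem_cons.1 hx with rfl | hx
    · exact hij.le
    · exact h x hx

theorem comm_of_basis {n : ℕ}
    (h : ∀ i j m, Multiset.card m ≤ n → Comm A (A i) (A j) (single m 1))
    (x y : g) {p : Multiset I →₀ k} (hp : p ∈ degLE k I n) : Comm A x y p := by
  have h1 : ∀ j, ∀ x : g, ∀ p ∈ degLE k I n, Comm A x (A j) p := fun j x p hp =>
    forall_degLE A (f := (polyAct A).compl₂ (polyAct A (A j)))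
      (f' := (polyAct A).compr₂ (polyAct A (A j)) +
        polyAct A ∘ₗ (LieModule.toEnd k g g : g →ₗ[k] Module.End k g).flip (A j))
      (fun i m hm => h i j m hm) x hp
  exact forall_degLE A (f := (polyAct A).compr₂ (polyAct A x))
      (f' := (polyAct A).compl₂ (polyAct A x) +
        polyAct A ∘ₗ (LieModule.toEnd k g g : g →ₗ[k] Module.End k g) x)
      (fun j m hm => h1 j x _ (single_mem hm)) y hp

/-- If $i$ or $j$ is at most the least letter $l$ of $m$, then `comm_of_lt`, up to symmetry, or
$i=j$ settles the claim. If $l$ is below both, write $m=l\cdot s$, move $l$ to the front by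
relations already known, and let the Jacobi identity match the brackets. -/
theorem comm_basis (n : ℕ) : ∀ (i j : I) (m : Multiset I), m.card ≤ n →
    Comm A (A i) (A j) (single m 1) := by
  induction n with
  | zero =>
    intro i j m hm
    obtain rfl : m = 0 := by simpa using hm
    rcases lt_trichotomy i j with h | rfl | h
    · exact (comm_of_lt A h _ (by simp)).symm
    · simp [Comm]
    · exact comm_of_lt A h _ (by simp)
  | succ n ih =>
    have ih' := fun x y p hp => comm_of_basis A ih x y (p := p) hp
    intro i j m hm
    rcases eq_or_ne m 0 with rfl | h0
    · exact ih i j 0 (by simp)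
    obtain ⟨l, s, rfl, hs⟩ := exists_min_cons m h0
    have hsn : s.card ≤ n := by rw [Multiset.card_cons] at hm; omega
    have hsP : (single s 1 : Multiset I →₀ k) ∈ degLE k I n := single_mem hsn
    have main : ∀ a b : I, l < a → l < b →
        polyAct A (A a) (polyAct A (A b) (single (l ::ₘ s) 1)) =
          polyAct A (A l) (polyAct A (A a) (polyAct A (A b) (single s 1)))
          + polyAct A ⁅A a, A l⁆ (polyAct A (A b) (single s 1))
          + polyAct A ⁅A b, A l⁆ (polyAct A (A a) (single s 1))
          + polyAct A ⁅A a, ⁅A b, A l⁆⁆ (single s 1) := by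
      intro a b ha hb
      -- The polynomial $b\,s$ may have degree $n+1$, out of reach of the induction hypothesis. Its
      -- leading monomial $bs$ has all letters at least $l$, so `comm_of_lt` covers it; the
      -- remainder has degree at most $n$.
      have e1 : Comm A (A a) (A l) (polyAct A (A b) (single s 1)) := by
        have hw := ih' (A a) (A l) _ (degLE_mono hsn (polyAct_sub_mem A b s))
        have hb' := comm_of_lt A ha (b ::ₘ s) (by
          intro x hx
          rcases Multiset.mem_cons.1 hx with rfl | hx
          · exact hb.le
          · exact hs x hx)
        unfold Comm at hw hb' ⊢
        rw [← sub_add_cancel (polyAct A (A b) (single s 1)) (single (b ::ₘ s) 1)]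
        generalize polyAct A (A b) (single s 1) - single (b ::ₘ s) 1 = w at hw
        simp only [map_add, hw, hb']
        abel
      have e2 := comm_of_lt A hb s hs
      have e3 := ih' (A a) ⁅A b, A l⁆ _ hsP
      unfold Comm at e1 e2 e3
      rw [← polyAct_of_le A l s hs, e2, map_add, e1, e3]
      abel
    -- In the difference of `main a b` and `main b a` the two middle terms cancel. The rest is
    -- $l[a,b]s+[[a,b],l]s$ by Jacobi, which is $[a,b](ls)$ by the induction hypothesis.
    have big : ∀ a b : I, l < a → l < b → Comm A (A a) (A b) (single (l ::ₘ s) 1) := by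
      intro a b ha hb
      have e1 := ih (a) (b) s hsn
      have e2 := ih' ⁅A a, A b⁆ (A l) _ hsP
      unfold Comm at e1 e2 ⊢
      rw [main a b ha hb, main b a hb ha, e1, leibniz_lie (A a), ← polyAct_of_le A l s hs, e2]
      simp only [map_add, LinearMap.add_apply]
      abel
    rcases lt_or_ge l i with hi | hi
    · rcases lt_or_ge l j with hj | hj
      · exact big i j hi hj
      · exact comm_of_lt A (hj.trans_lt hi) _ (by
          intro x hx
          rcases Multiset.mem_cons.1 hx with rfl | hx
          · exact hj
          · exact hj.trans (hs x hx))
    · have hil : ∀ x ∈ l ::ₘ s, i ≤ x := by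
        intro x hx
        rcases Multiset.mem_cons.1 hx with rfl | hx
        · exact hi
        · exact hi.trans (hs x hx)
      rcases lt_trichotomy i j with h | rfl | h
      · exact (comm_of_lt A h _ hil).symm
      · simp [Comm]
      · refine comm_of_lt A h _ fun x hx => h.le.trans (hil x hx)

attribute [local instance] LieRing.ofAssociativeRing in
/-- The action of `g` on polynomials as a homomorphism of Lie algebras. -/
def polyRep : g →ₗ⁅k⁆ Module.End k (Multiset I →₀ k) where
  __ := polyAct A
  map_lie' {x y} := by
    ext1 m
    ext1
    have h : Comm A x y (single m 1) :=
      comm_of_basis A (comm_basis A m.card) x y (single_mem le_rfl)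
    unfold Comm at h
    simp [LieRing.of_associative_ring_bracket, h]

theorem polyRep_apply (x : g) : polyRep A x = polyAct A x := rfl

/-! ### Poincaré-Birkhoff-Witt: ordered monomials form a basis. -/

/-- The monomial `a_{i₁} ⋯ a_{iₙ}` in the universal enveloping algebra. -/
def monomial (l : List I) : UniversalEnvelopingAlgebra k g :=
  (l.map fun i => UniversalEnvelopingAlgebra.ι k (A i)).prod

/-- Letters act from the right end, so each one meets a monomial with no smaller letter and
multiplies it without corrections. -/
theorem lift_monomial (l : List I) (hl : l.Pairwise (· ≤ ·)) :
    UniversalEnvelopingAlgebra.lift k (polyRep A) (monomial A l) (single 0 1) =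
      single (l : Multiset I) 1 := by
  induction l with
  | nil => simp [monomial]
  | cons i l ih =>
    rw [List.pairwise_cons] at hl
    have : monomial A (i :: l) = UniversalEnvelopingAlgebra.ι k (A i) * monomial A l := by
      simp [monomial]
    rw [this, map_mul, UniversalEnvelopingAlgebra.lift_ι_apply, Module.End.mul_apply, ih hl.2,
      polyRep_apply, polyAct_of_le A i _ (by simpa using hl.1)]
    rfl

/-- The linear independence part of the Poincaré-Birkhoff-Witt theorem. -/
theorem linearIndependent_monomial :
    LinearIndependent k (fun l : {l : List I // l.Pairwise (· ≤ ·)} => monomial A l.1) := by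
  let ev : UniversalEnvelopingAlgebra k g →ₗ[k] (Multiset I →₀ k) :=
    (LinearMap.applyₗ (single 0 1 : Multiset I →₀ k)) ∘ₗ
      (UniversalEnvelopingAlgebra.lift k (polyRep A)).toLinearMap
  apply LinearIndependent.of_comp ev
  have : (ev ∘ fun l : {l : List I // l.Pairwise (· ≤ ·)} => monomial A l.1) =
      (fun m : Multiset I => single m (1 : k)) ∘
        fun l : {l : List I // l.Pairwise (· ≤ ·)} => (l.1 : Multiset I) :=
    funext fun l => lift_monomial A l.1 l.2
  rw [this]
  refine (Finsupp.basisSingleOne (R := k) (ι := Multiset I)).linearIndependent.comp _ ?_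
  intro l l' h
  -- A sorted list is determined by its multiset.
  exact Subtype.ext ((Multiset.coe_eq_coe.1 h).eq_of_pairwise' l.2 l'.2)

/-- The span of the products of at most `n` basis elements. -/
def filt (n : ℕ) : Submodule k (UniversalEnvelopingAlgebra k g) :=
  Submodule.span k (monomial A '' {l | l.length ≤ n})

theorem monomial_mem_filt {l : List I} {n : ℕ} (h : l.length ≤ n) : monomial A l ∈ filt A n :=
  Submodule.subset_span ⟨l, h, rfl⟩

theorem monomial_cons (i : I) (l : List I) :
    monomial A (i :: l) = UniversalEnvelopingAlgebra.ι k (A i) * monomial A l := by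
  simp [monomial]

theorem ι_mul_mem_filt (x : g) {n : ℕ} {u : UniversalEnvelopingAlgebra k g} (hu : u ∈ filt A n) :
    UniversalEnvelopingAlgebra.ι k x * u ∈ filt A (n + 1) := by
  induction hu using Submodule.span_induction with
  | mem u hu =>
    obtain ⟨l, hl, rfl⟩ := hu
    induction A.mem_span x using Submodule.span_induction with
    | zero => simp
    | add x y _ _ hx hy => rw [map_add, add_mul]; exact add_mem hx hy
    | smul c x _ hx => rw [map_smul, smul_mul_assoc]; exact Submodule.smul_mem _ _ hx
    | mem x hx =>
      obtain ⟨i, rfl⟩ := hx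
      rw [← monomial_cons]
      exact monomial_mem_filt A (Nat.succ_le_succ hl)
  | zero => simp
  | add u v _ _ hu hv => rw [mul_add]; exact add_mem hu hv
  | smul c u _ hu => rw [mul_smul_comm]; exact Submodule.smul_mem _ _ hu

-- Swapping two adjacent letters changes the product by a commutator, which is a single element of
-- the Lie algebra; the difference therefore needs one letter fewer.
attribute [local instance] LieRing.ofAssociativeRing in
theorem monomial_sub_mem {l l' : List I} (h : l.Perm l') :
    ∀ n, l.length ≤ n + 1 → monomial A l - monomial A l' ∈ filt A n := by
  induction h with
  | nil => intro n _; simp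
  | cons i p ih =>
    intro n hn
    rw [monomial_cons, monomial_cons, ← mul_sub]
    cases n with
    | zero =>
      obtain rfl := List.eq_nil_of_length_eq_zero (by simpa using hn)
      obtain rfl := p.nil_eq
      simp
    | succ n => exact ι_mul_mem_filt A _ (ih n (by simpa using hn))
  | swap i j l =>
    intro n hn
    simp only [monomial_cons, ← mul_assoc, ← sub_mul]
    rw [← LieRing.of_associative_ring_bracket, ← LieHom.map_lie]
    cases n with
    | zero => simp at hn
    | succ n =>
      exact ι_mul_mem_filt A _ (monomial_mem_filt A (by simpa using hn))
  | trans p q hp hq =>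
    intro n hn
    rw [← sub_add_sub_cancel]
    exact add_mem (hp n hn) (hq n (p.length_eq ▸ hn))

theorem monomial_mem_span (n : ℕ) : ∀ l : List I, l.length ≤ n → monomial A l ∈
    Submodule.span k (Set.range fun l : {l : List I // l.Pairwise (· ≤ ·)} => monomial A l.1) := by
  induction n with
  | zero =>
    intro l hl
    obtain rfl := List.eq_nil_of_length_eq_zero (by simpa using hl)
    exact Submodule.subset_span ⟨⟨[], List.Pairwise.nil⟩, rfl⟩
  | succ n ih =>
    intro l hl
    -- A word is its sorted version plus a combination of shorter words, which the induction covers.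
    have hs : (l.mergeSort (· ≤ ·)).Pairwise (· ≤ ·) := List.pairwise_mergeSort' _ l
    rw [← sub_add_cancel (monomial A l) (monomial A (l.mergeSort (· ≤ ·)))]
    refine add_mem ?_ (Submodule.subset_span ⟨⟨_, hs⟩, rfl⟩)
    refine (Submodule.span_le.2 ?_ : filt A n ≤ _)
      (monomial_sub_mem A (List.mergeSort_perm l _).symm n hl)
    rintro _ ⟨l, hl, rfl⟩
    exact ih l hl

theorem induction_on {P : UniversalEnvelopingAlgebra k g → Prop}
    (u : UniversalEnvelopingAlgebra k g)
    (algebraMap : ∀ c, P (algebraMap k _ c)) (ι : ∀ x, P (UniversalEnvelopingAlgebra.ι k x))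
    (mul : ∀ u v, P u → P v → P (u * v)) (add : ∀ u v, P u → P v → P (u + v)) : P u := by
  obtain ⟨t, rfl⟩ : ∃ t, UniversalEnvelopingAlgebra.mkAlgHom k g t = u :=
    RingCon.mk'_surjective _ u
  induction t using TensorAlgebra.induction with
  | algebraMap c => rw [AlgHom.commutes]; exact algebraMap c
  | ι x => exact ι x
  | mul s t hs ht => rw [map_mul]; exact mul _ _ hs ht
  | add s t hs ht => rw [map_add]; exact add _ _ hs ht

/-- The spanning part of the Poincaré-Birkhoff-Witt theorem. -/
theorem span_monomial :
    Submodule.span k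
      (Set.range fun l : {l : List I // l.Pairwise (· ≤ ·)} => monomial A l.1) = ⊤ := by
  -- The union of the filtration is stable under left multiplication by all of $U(\mathfrak g)$; as
  -- it contains $1$, it is everything.
  have key : ∀ u w : UniversalEnvelopingAlgebra k g, (∃ n, w ∈ filt A n) →
      ∃ n, u * w ∈ filt A n := by
    intro u
    induction u using induction_on with
    | algebraMap c =>
      rintro w ⟨n, hw⟩
      exact ⟨n, by rw [← Algebra.smul_def]; exact Submodule.smul_mem _ _ hw⟩
    | ι x => rintro w ⟨n, hw⟩; exact ⟨n + 1, ι_mul_mem_filt A x hw⟩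
    | mul u v hu hv => intro w hw; rw [mul_assoc]; exact hu _ (hv _ hw)
    | add u v hu hv =>
      intro w hw
      obtain ⟨n, hn⟩ := hu w hw
      obtain ⟨m, hm⟩ := hv w hw
      have mono : ∀ {a b}, a ≤ b → filt A a ≤ filt A b := fun h =>
        Submodule.span_mono (Set.image_mono fun _ hl => le_trans hl h)
      refine ⟨max n m, ?_⟩
      rw [add_mul]
      exact add_mem (mono (le_max_left _ _) hn) (mono (le_max_right _ _) hm)
  rw [eq_top_iff]
  intro u _
  obtain ⟨n, hn⟩ := key u 1 ⟨0, monomial_mem_filt A (l := []) le_rfl⟩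
  rw [mul_one] at hn
  refine (Submodule.span_le.2 ?_ : filt A n ≤ _) hn
  rintro _ ⟨l, hl, rfl⟩
  exact monomial_mem_span A n l hl

/-- The Poincaré-Birkhoff-Witt basis. -/
def basis : Module.Basis {l : List I // l.Pairwise (· ≤ ·)} k (UniversalEnvelopingAlgebra k g) :=
  Module.Basis.mk (linearIndependent_monomial A) (span_monomial A).ge

theorem basis_apply (l : {l : List I // l.Pairwise (· ≤ ·)}) : basis A l = monomial A l.1 := by
  simp [basis]

end PBW
end

noncomputable section

namespace ConfLeibniz

theorem FreeDialg.lact_one {k L : Type*} [Field k] [AddCommGroup L] [Module k L]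
    (X : FreeDialg k L) : lact k L 1 X = X := by
  induction X using induction_on with
  | h0 => simp
  | ht u x v => simp
  | ha X Y hX hY => rw [map_add, hX, hY]

theorem FreeDialg.ract_one {k L : Type*} [Field k] [AddCommGroup L] [Module k L]
    (X : FreeDialg k L) : ract k L 1 X = X := by
  induction X using induction_on with
  | h0 => simp
  | ht u x v => simp
  | ha X Y hX hY => rw [map_add, hX, hY]

/-! ### The surjection $L\otimes U(L^{\mathrm{alg}})\to U(L)$. -/

section RightAction

variable (k : Type*) [Field k] (L : Type*) [AddCommGroup L] [Module k L] [LeibnizAlgebra k L]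

theorem rp_ι_ι (a b : L) : rp k (Env.ι k a) (Env.ι k b) =
    lp k (Env.ι k b) (Env.ι k a) + Env.ι k (br k a b) := by
  have h := (Submodule.Quotient.mk_eq_zero _).2 (envRel_subset k L ⟨a, b, rfl⟩)
  rw [Submodule.Quotient.mk_sub, Submodule.Quotient.mk_sub, sub_eq_zero, sub_eq_iff_eq_add'] at h
  exact h

/-- The right multiplication `x ↦ x ⊣ ã` of `U(L)`. -/
def rightMul : L →ₗ[k] Module.End k (Env k L) :=
  (AssocDialgebra.lp : Env k L →ₗ[k] Env k L →ₗ[k] Env k L).flip ∘ₗ Env.ι k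

theorem rightMul_apply (a : L) (x : Env k L) : rightMul k L a x = lp k x (Env.ι k a) := rfl

/-- To the right of $\dashv$, the axiom `lp_bar` turns $a\vdash b$ into $a\dashv b$, so the defining
relation becomes an associative commutator. Right multiplications compose in reverse order, whence
the opposite algebra below. -/
theorem rightMul_br (a b : L) :
    rightMul k L (br k a b) = rightMul k L b * rightMul k L a - rightMul k L a * rightMul k L b := by
  refine LinearMap.ext fun x => ?_
  have h : lp k x (Env.ι k (br k a b)) =
      lp k x (rp k (Env.ι k a) (Env.ι k b)) - lp k x (lp k (Env.ι k b) (Env.ι k a)) := by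
    rw [rp_ι_ι]
    exact eq_sub_of_add_eq' (map_add (AssocDialgebra.lp (k := k) x) _ _).symm
  rw [rightMul_apply, h]
  change _ = lp k (lp k x (Env.ι k a)) (Env.ι k b) - lp k (lp k x (Env.ι k b)) (Env.ι k a)
  rw [show lp k x (rp k (Env.ι k a) (Env.ι k b)) = lp k x (lp k (Env.ι k a) (Env.ι k b)) from
    AssocDialgebra.lp_bar _ _ _]
  exact congrArg₂ (· - ·) (AssocDialgebra.lp_assoc _ _ _).symm
    (AssocDialgebra.lp_assoc _ _ _).symm

theorem leibKer_le_ker_rightMul : leibKer k L ≤ LinearMap.ker (rightMul k L) := by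
  refine Submodule.span_le.2 ?_
  rintro _ ⟨a, rfl⟩
  exact (rightMul_br k L a a).trans (sub_self _)

/-- The map `ā ↦ (x ↦ x ⊣ ã)` on `L^alg`. -/
def rightMulAlg : LAlg k L →ₗ[k] (Module.End k (Env k L))ᵐᵒᵖ :=
  (MulOpposite.opLinearEquiv k).toLinearMap ∘ₗ
    (leibKer k L).liftQ (rightMul k L) (leibKer_le_ker_rightMul k L)

theorem rightMulAlg_toAlg (a : L) :
    rightMulAlg k L (toAlg k a) = MulOpposite.op (rightMul k L a) := rfl

attribute [local instance] LieRing.ofAssociativeRing in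
/-- The right action of `U(L^alg)` on the dialgebra `U(L)`. -/
def rightAct : UniversalEnvelopingAlgebra k (LAlg k L) →ₐ[k] (Module.End k (Env k L))ᵐᵒᵖ :=
  UniversalEnvelopingAlgebra.lift k
    { rightMulAlg k L with
      map_lie' := fun {x y} => by
        obtain ⟨a, rfl⟩ := toAlg_surjective k L x
        obtain ⟨b, rfl⟩ := toAlg_surjective k L y
        change rightMulAlg k L (toAlg k (br k a b)) =
          ⁅rightMulAlg k L (toAlg k a), rightMulAlg k L (toAlg k b)⁆
        rw [rightMulAlg_toAlg, rightMulAlg_toAlg, rightMulAlg_toAlg, rightMul_br,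
          LieRing.of_associative_ring_bracket]
        rfl }

theorem rightAct_ι (a : L) (x : Env k L) :
    (rightAct k L (UniversalEnvelopingAlgebra.ι k (toAlg k a))).unop x = lp k x (Env.ι k a) := by
  rw [rightAct, UniversalEnvelopingAlgebra.lift_ι_apply]
  rfl

theorem rightAct_mul (u v : UniversalEnvelopingAlgebra k (LAlg k L)) (x : Env k L) :
    (rightAct k L (u * v)).unop x = (rightAct k L v).unop ((rightAct k L u).unop x) := by
  rw [map_mul]; rfl

/-- On generators this is the axiom $(x\vdash y)\dashv z=x\vdash(y\dashv z)$. -/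
theorem rp_rightAct (u : UniversalEnvelopingAlgebra k (LAlg k L)) (x y : Env k L) :
    rp k x ((rightAct k L u).unop y) = (rightAct k L u).unop (rp k x y) := by
  induction u using PBW.induction_on generalizing y with
  | algebraMap c => rw [AlgHom.commutes]; exact map_smul (AssocDialgebra.rp (k := k) x) c y
  | ι a =>
    obtain ⟨a, rfl⟩ := toAlg_surjective k L a
    rw [rightAct_ι, rightAct_ι]
    exact (AssocDialgebra.mid_assoc _ _ _).symm
  | mul u v hu hv => rw [rightAct_mul, rightAct_mul, hv, hu]
  | add u v hu hv =>
    rw [map_add, MulOpposite.unop_add, LinearMap.add_apply, LinearMap.add_apply, ← hu, ← hv]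
    exact map_add (AssocDialgebra.rp (k := k) x) _ _

/-- The map `c ⊗ u ↦ c̃ ⊣ u`. -/
def envOfTensor : L ⊗[k] UniversalEnvelopingAlgebra k (LAlg k L) →ₗ[k] Env k L :=
  TensorProduct.lift ((((MulOpposite.opLinearEquiv k).symm.toLinearMap ∘ₗ
    (rightAct k L).toLinearMap).flip) ∘ₗ Env.ι k)

theorem envOfTensor_tmul (c : L) (u : UniversalEnvelopingAlgebra k (LAlg k L)) :
    envOfTensor k L (c ⊗ₜ u) = (rightAct k L u).unop (Env.ι k c) := rfl

theorem lp_envOfTensor_mem (a : L) {x : Env k L} (hx : x ∈ LinearMap.range (envOfTensor k L)) :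
    lp k x (Env.ι k a) ∈ LinearMap.range (envOfTensor k L) := by
  obtain ⟨t, rfl⟩ := hx
  change rightMul k L a _ ∈ _
  induction t using TensorProduct.induction_on with
  | zero => simp
  | add s t hs ht => rw [map_add, map_add]; exact add_mem hs ht
  | tmul c u =>
    refine ⟨c ⊗ₜ (u * UniversalEnvelopingAlgebra.ι k (toAlg k a)), ?_⟩
    rw [envOfTensor_tmul, rightAct_mul, rightAct_ι]
    rfl

theorem rp_envOfTensor_mem (a : L) {x : Env k L} (hx : x ∈ LinearMap.range (envOfTensor k L)) :
    rp k (Env.ι k a) x ∈ LinearMap.range (envOfTensor k L) := by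
  obtain ⟨t, rfl⟩ := hx
  change (AssocDialgebra.rp (k := k) (Env.ι k a)) _ ∈ _
  induction t using TensorProduct.induction_on with
  | zero => simp
  | add s t hs ht => rw [map_add, map_add]; exact add_mem hs ht
  | tmul c u =>
    -- The witness comes from $\tilde a\vdash(\tilde c\dashv u)=(\tilde a\vdash\tilde c)\dashv
    -- u=(\tilde c\dashv\tilde a+\widetilde{[ac]})\dashv u$.
    refine ⟨c ⊗ₜ (UniversalEnvelopingAlgebra.ι k (toAlg k a) * u) + br k a c ⊗ₜ u, ?_⟩
    rw [map_add, envOfTensor_tmul, envOfTensor_tmul, envOfTensor_tmul, rightAct_mul, rightAct_ι,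
      ← map_add, ← rp_ι_ι]
    exact (rp_rightAct k L u _ _).symm

/-- The free dialgebra is spanned by $u\vdash x\dashv v$, which arise from generators by left
$\vdash$ and right $\dashv$ multiplication by letters. The preimage `R` of the range contains the
generators and is stable under both. -/
theorem envOfTensor_surjective : Function.Surjective (envOfTensor k L) := by
  let R := (LinearMap.range (envOfTensor k L)).comap (envIdeal k L).mkQ
  have hr : ∀ v : TensorAlgebra k L, ∀ X ∈ R, FreeDialg.ract k L v X ∈ R := by
    intro v
    induction v using TensorAlgebra.induction with
    | algebraMap c =>
      intro X hX
      rw [Algebra.algebraMap_eq_smul_one, map_smul, LinearMap.smul_apply, FreeDialg.ract_one]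
      exact R.smul_mem c hX
    | ι x =>
      intro X hX
      rw [← FreeDialg.proj_of]
      exact lp_envOfTensor_mem k L x hX
    | mul s t hs ht => intro X hX; rw [FreeDialg.ract_mul]; exact ht _ (hs _ hX)
    | add s t hs ht =>
      intro X hX; rw [map_add]; exact add_mem (hs X hX) (ht X hX)
  have hl : ∀ v : TensorAlgebra k L, ∀ X ∈ R, FreeDialg.lact k L v X ∈ R := by
    intro v
    induction v using TensorAlgebra.induction with
    | algebraMap c =>
      intro X hX
      rw [Algebra.algebraMap_eq_smul_one, map_smul, LinearMap.smul_apply, FreeDialg.lact_one]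
      exact R.smul_mem c hX
    | ι x =>
      intro X hX
      rw [← FreeDialg.proj_of]
      exact rp_envOfTensor_mem k L x hX
    | mul s t hs ht => intro X hX; rw [FreeDialg.lact_mul]; exact hs _ (ht _ hX)
    | add s t hs ht =>
      intro X hX; rw [map_add]; exact add_mem (hs X hX) (ht X hX)
  intro y
  obtain ⟨X, rfl⟩ := Submodule.Quotient.mk_surjective _ y
  change X ∈ R
  induction X using FreeDialg.induction_on with
  | h0 => exact zero_mem _
  | ha X Y hX hY => exact add_mem hX hY
  | ht u x v =>
    have hx : FreeDialg.of k x ∈ R := ⟨x ⊗ₜ 1, by rw [envOfTensor_tmul, map_one]; rfl⟩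
    have := hl u _ (hr v _ hx)
    rwa [FreeDialg.of_apply, FreeDialg.ract_tmul, FreeDialg.lact_tmul, one_mul, mul_one] at this

end RightAction

/-! ### Reading $c\otimes u$ off the representation $\rho_U$. -/

section Recover

variable (k : Type*) [Field k] (L : Type*) [AddCommGroup L] [Module k L] [LeibnizAlgebra k L]

/-- The functional `f ⊗ g ↦ f'(0) g(0)` on `H ⊗ H`. -/
def linCoeff : HH k →ₗ[k] k :=
  (TensorProduct.lid k k).toLinearMap ∘ₗ
    TensorProduct.map (Polynomial.lcoeff k 1) (Polynomial.lcoeff k 0)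

theorem linCoeff_tmul (f g : k[X]) : linCoeff k (HH.tmul f g) = f.coeff 1 * g.coeff 0 := rfl

/-- The coefficient map `(H ⊗ H) ⊗_H (H ⊗ N) ≅ (H ⊗ H) ⊗ N → N` given by `linCoeff`. -/
def linPart (N : Type*) [AddCommGroup N] [Module k N] : Pseudo k (k[X] ⊗[k] N) →ₗ[k] N :=
  (TensorProduct.lid k N).toLinearMap ∘ₗ LinearMap.rTensor N (linCoeff k) ∘ₗ
    (TensorProduct.AlgebraTensorModule.cancelBaseChange k k[X] k[X]
      (HH k) N).toLinearMap.restrictScalars k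

theorem linPart_tmul (N : Type*) [AddCommGroup N] [Module k N] (F : HH k) (n : N) :
    linPart k N (F ⊗ₜ[k[X]] ((1 : k[X]) ⊗ₜ[k] n)) = linCoeff k F • n := by
  simp [linPart]

/-- The map that recovers `t` from the image of `envOfTensor t` in `Cend M`. -/
def recover : Cend k (RepModule k L (UniversalEnvelopingAlgebra k (LAlg k L))) →ₗ[k]
    L ⊗[k] UniversalEnvelopingAlgebra k (LAlg k L) :=
  -- The operator is evaluated at $1\in V=U(L^{\mathrm{alg}})$. The minus sign cancels the one in
  -- front of $T\otimes1\otimes_H(c\otimes u)$ in $\rho_U$.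
  -(LinearMap.snd k _ _ ∘ₗ linPart k _ ∘ₗ LinearMap.applyₗ ((1 : k[X]) ⊗ₜ[k] (1, 0)) ∘ₗ
    Submodule.subtype _)

theorem envRep_ι (c : L) : (envRep (repU k L)).toLinearMap (Env.ι k c) = repLin k L _ c :=
  Env.lift_ι _ _

/-- The map `y ↦ U(ρ_U)(y)(1 ⊗ v)` on `U(L)`, for `v ∈ V`. -/
def evalRep (v : UniversalEnvelopingAlgebra k (LAlg k L)) : Env k L →ₗ[k]
    Pseudo k (RepModule k L (UniversalEnvelopingAlgebra k (LAlg k L))) :=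
  LinearMap.applyₗ ((1 : k[X]) ⊗ₜ[k] (v, 0)) ∘ₗ Submodule.subtype _ ∘ₗ
    (envRep (repU k L)).toLinearMap

theorem evalRep_apply (v : UniversalEnvelopingAlgebra k (LAlg k L)) (y : Env k L) :
    evalRep k L v y = ((envRep (repU k L)).toLinearMap y).1 ((1 : k[X]) ⊗ₜ[k] (v, 0)) := rfl

theorem evalRep_add (u v : UniversalEnvelopingAlgebra k (LAlg k L)) (y : Env k L) :
    evalRep k L (u + v) y = evalRep k L u y + evalRep k L v y := by
  have hp : ((u + v, 0) : BaseSpace k L (UniversalEnvelopingAlgebra k (LAlg k L))) =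
      (u, 0) + (v, 0) := by
    simp
  rw [evalRep_apply, hp, TensorProduct.tmul_add, map_add]
  rfl

theorem evalRep_smul (c : k) (v : UniversalEnvelopingAlgebra k (LAlg k L)) (y : Env k L) :
    evalRep k L (c • v) y = c • evalRep k L v y := by
  have hp : ((c • v, 0) : BaseSpace k L (UniversalEnvelopingAlgebra k (LAlg k L))) =
      c • (v, 0) := by
    simp
  rw [evalRep_apply, hp, TensorProduct.tmul_smul, map_smul]
  rfl

/-- In $\mathrm{Cend}\,M^{(0)}$ one has $(y\dashv b)(v)=y(b\circ_0v)$, and setting $T=0$ in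
$\rho_U(a)(v)$ leaves $\bar av$. -/
theorem evalRep_lp_ι (v : UniversalEnvelopingAlgebra k (LAlg k L)) (y : Env k L) (a : L) :
    evalRep k L v (lp k y (Env.ι k a)) =
      evalRep k L (UniversalEnvelopingAlgebra.ι k (toAlg k a) * v) y := by
  have h := (envRep (repU k L)).map_lp y (Env.ι k a)
  rw [envRep_ι] at h
  refine (congrArg (fun b => b.1 ((1 : k[X]) ⊗ₜ[k] (v, 0))) h).trans ?_
  change ((envRep (repU k L)).toLinearMap y).1 (zeroAct (repLin k L _ a) _) = _
  rw [zeroAct_repLin, coeff₀_inl]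
  rfl

theorem evalRep_rightAct (u v : UniversalEnvelopingAlgebra k (LAlg k L)) (y : Env k L) :
    evalRep k L v ((rightAct k L u).unop y) = evalRep k L (u * v) y := by
  induction u using PBW.induction_on generalizing y v with
  | algebraMap c =>
    rw [AlgHom.commutes, ← Algebra.smul_def, evalRep_smul]
    exact map_smul (evalRep k L v) c y
  | ι a =>
    obtain ⟨a, rfl⟩ := toAlg_surjective k L a
    exact (congrArg (evalRep k L v) (rightAct_ι k L a y)).trans (evalRep_lp_ι k L v y a)
  | mul u w hu hw =>
    refine (congrArg (evalRep k L v) (rightAct_mul k L u w y)).trans ?_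
    rw [hw, hu, mul_assoc]
  | add u w hu hw =>
    rw [add_mul, evalRep_add, ← hu, ← hw, ← map_add, map_add]
    rfl

/-- By `evalRep_rightAct`, the value of $\tilde c\dashv u$ at $1$ is that of $\rho_U(c)$ at
$u\cdot1=u$, whose $T$-coefficient is $-c\otimes u$. Using the regular module ensures that $u$
itself is seen. -/
theorem recover_envRep_envOfTensor (t : L ⊗[k] UniversalEnvelopingAlgebra k (LAlg k L)) :
    recover k L ((envRep (repU k L)).toLinearMap (envOfTensor k L t)) = t := by
  induction t using TensorProduct.induction_on with
  | zero => simp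
  | add s t hs ht => rw [map_add, map_add, map_add, hs, ht]
  | tmul c u =>
    change -(linPart k _ (evalRep k L 1 (envOfTensor k L (c ⊗ₜ u)))).2 = _
    rw [envOfTensor_tmul, evalRep_rightAct, mul_one, evalRep_apply, envRep_ι, repLin_tmul, map_sub,
      linPart_tmul, linPart_tmul, linCoeff_tmul, linCoeff_tmul, coeff₁_apply]
    simp [Polynomial.coeff_one]

theorem envRep_repU_injective : Function.Injective (envRep (repU k L)).toLinearMap := by
  intro x y h
  obtain ⟨s, rfl⟩ := envOfTensor_surjective k L x
  obtain ⟨t, rfl⟩ := envOfTensor_surjective k L y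
  rw [← recover_envRep_envOfTensor k L s, h, recover_envRep_envOfTensor]

variable {k L}

/-- In a right action the leftmost factor acts first, which is the left bracketing of `envWord`; the
induction needs an arbitrary starting element in place of $\tilde c$. -/
theorem envOfTensor_monomial {I : Type*} [LinearOrder I] (A : Module.Basis I k (LAlg k L))
    (a : I → L) (ha : ∀ i, toAlg k (a i) = A i) (c : L) (l : List I) :
    envOfTensor k L (c ⊗ₜ PBW.monomial A l) = envWord k c a l := by
  rw [envOfTensor_tmul, envWord]
  generalize Env.ι k c = x
  induction l generalizing x with
  | nil => simp [PBW.monomial]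
  | cons i l ih =>
    rw [PBW.monomial_cons, rightAct_mul, ← ha, rightAct_ι, ih, List.foldl_cons]

end Recover

end ConfLeibniz

end

theorem theorem6 {k : Type*} [Field k] {L : Type*} [AddCommGroup L] [Module k L]
    [ConfLeibniz.LeibnizAlgebra k L] :
    Function.Injective
        (ConfLeibniz.envRep (ConfLeibniz.repU k L)).toLinearMap ∧
      ∀ {I J : Type*} [LinearOrder I] (B : Module.Basis (I ⊕ J) k L)
        (A : Module.Basis I k (ConfLeibniz.LAlg k L)),
        (∀ i : I, ConfLeibniz.toAlg k (B (Sum.inl i)) = A i) →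
        (∀ j : J, ConfLeibniz.toAlg k (B (Sum.inr j)) = 0) →
        Submodule.span k (Set.range fun w : (I ⊕ J) × {l : List I // l.Pairwise (· ≤ ·)} =>
            ConfLeibniz.envWord k (B w.1) (fun i : I => B (Sum.inl i)) w.2.1) = ⊤ ∧
          LinearIndependent k
            (fun w : (I ⊕ J) × {l : List I // l.Pairwise (· ≤ ·)} =>
              (ConfLeibniz.envRep (ConfLeibniz.repU k L)).toLinearMap
                (ConfLeibniz.envWord k (B w.1) (fun i : I => B (Sum.inl i)) w.2.1)) := by
  refine ⟨ConfLeibniz.envRep_repU_injective k L, ?_⟩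
  intro I J _ B A hA _
  -- `envOfTensor` carries this basis of $L\otimes U(L^{\mathrm{alg}})$ to the words. Spanning
  -- follows from surjectivity, independence of the images from the left inverse `recover`.
  let E := B.tensorProduct (PBW.basis A)
  have hE : ∀ w, ConfLeibniz.envOfTensor k L (E w) =
      ConfLeibniz.envWord k (B w.1) (fun i : I => B (Sum.inl i)) w.2.1 := fun w => by
    rw [← ConfLeibniz.envOfTensor_monomial A _ hA, Module.Basis.tensorProduct_apply',
      PBW.basis_apply]
  constructor
  · simp_rw [← hE]
    rw [Set.range_comp' (ConfLeibniz.envOfTensor k L) E, Submodule.span_image, E.span_eq,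
      Submodule.map_top, LinearMap.range_eq_top]
    exact ConfLeibniz.envOfTensor_surjective k L
  · apply LinearIndependent.of_comp (ConfLeibniz.recover k L)
    simp_rw [← hE]
    have : (ConfLeibniz.recover k L ∘ fun w =>
        (ConfLeibniz.envRep (ConfLeibniz.repU k L)).toLinearMap
          (ConfLeibniz.envOfTensor k L (E w))) = E :=
      funext fun w => ConfLeibniz.recover_envRep_envOfTensor k L (E w)
    rw [this]
    exact E.linearIndependent
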